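/- For a permutation $\pi\in\mathfrak S_n$ ($n\ge 0$) let $\ell(\pi)$ be the least $k$ such that $\pi=s_{i_1}\cdots s_{i_k}$ is a product of $k$ simple reflections $s_i=(i\ i{+}1)$, and let $R(\pi)$ be the set of reduced words $i_1\cdots i_k$ (those with $k=\ell(\pi)$). Let $G_\pi$ be the graph on $R(\pi)$ in which two words are adjacent if they differ by a commutation move (switching adjacent letters $jk$ with $|j-k|>1$) or by a long braid move (exchanging $j(j+1)j$ and $(j+1)j(j+1)$ on consecutive positions). Let $C_\pi$ be the simple graph obtained from $G_\pi$ by contracting all commutation edges, and $B_\pi$ the simple graph obtained from $G_\pi$ by contracting all long braid edges. These graphs are connected; $\operatorname{diam}$ denotes the maximum distance between two vertices. Let $a,b\ge 0$, let $\alpha\in\mathfrak S_a$, and let $\pi=21[\alpha,\iota_b]\in\mathfrak S_{a+b}$ be the permutation with one-line notation $(\alpha_1+b)\cdots(\alpha_a+b)\,1\,2\cdots b$. Then $G_\alpha,C_\alpha,B_\alpha,G_\pi,C_\pi,B_\pi$ are connected and (i) $\operatorname{diam}(G_\alpha)+\ell(\alpha)b(a-1)+\binom a2\binom b2\le\operatorname{diam}(G_\pi)\le\operatorname{diam}(G_\alpha)+\ell(\alpha)b(a-1)+2\binom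 a2\binom b2$; (ii) $\operatorname{diam}(C_\pi)=\operatorname{diam}(C_\alpha)+\ell(\alpha)b$; (iii) $\operatorname{diam}(B_\alpha)+\ell(\alpha)b(a-2)+\binom a2\binom b2\le\operatorname{diam}(B_\pi)\le\operatorname{diam}(B_\alpha)+\ell(\alpha)b(a-2)+2\binom a2\binom b2$. -/

import Mathlib

namespace ReducedWords

/-- The simple reflection `s_i` of `Fin n`, interchanging the consecutive elements `i` and `i + 1`
(elements and letters are numbered from `0`, so the letters are `0, …, n - 2`). -/
def simpleRefl {n : ℕ} (i : Fin (n - 1)) : Equiv.Perm (Fin n) :=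
  Equiv.swap ⟨i.val, by omega⟩ ⟨i.val + 1, by omega⟩

/-- The product `s_{i₁} s_{i₂} ⋯ s_{i_k}` of a word `i₁ i₂ ⋯ i_k`, composed as functions
(the rightmost factor acts first). -/
def wordProd {n : ℕ} (w : List (Fin (n - 1))) : Equiv.Perm (Fin n) :=
  (w.map simpleRefl).prod

/-- The length `ℓ(π)`: the least number of simple reflections with product `π`. -/
noncomputable def permLength {n : ℕ} (π : Equiv.Perm (Fin n)) : ℕ :=
  sInf {k : ℕ | ∃ w : List (Fin (n - 1)), w.length = k ∧ wordProd w = π}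

/-- The set `R(π)` of reduced words of `π`. -/
def reducedWords {n : ℕ} (π : Equiv.Perm (Fin n)) : Set (List (Fin (n - 1))) :=
  {w | wordProd w = π ∧ w.length = permLength π}

/-- A commutation move: adjacent letters `j k` with `|j - k| > 1` are switched. -/
def CommMove {m : ℕ} (u v : List (Fin m)) : Prop :=
  ∃ (p q : List (Fin m)) (j k : Fin m), (j.val + 1 < k.val ∨ k.val + 1 < j.val) ∧
    u = p ++ [j, k] ++ q ∧ v = p ++ [k, j] ++ q

/-- A long braid move: `j (j+1) j` and `(j+1) j (j+1)`, on consecutive positions, are exchanged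
(in either direction). -/
def LongBraidMove {m : ℕ} (u v : List (Fin m)) : Prop :=
  ∃ (p q : List (Fin m)) (j k : Fin m), (j.val + 1 = k.val ∨ k.val + 1 = j.val) ∧
    u = p ++ [j, k, j] ++ q ∧ v = p ++ [k, j, k] ++ q

theorem CommMove.symm {m : ℕ} {u v : List (Fin m)} (h : CommMove u v) : CommMove v u := by
  obtain ⟨p, q, j, k, hjk, hu, hv⟩ := h
  exact ⟨p, q, k, j, hjk.symm, hv, hu⟩

theorem CommMove.ne {m : ℕ} {u v : List (Fin m)} (h : CommMove u v) : u ≠ v := by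
  obtain ⟨p, q, j, k, hjk, rfl, rfl⟩ := h
  intro he
  simp only [List.append_assoc, List.append_cancel_left_eq, List.cons_append,
    List.cons.injEq] at he
  have := congrArg Fin.val he.1
  omega

theorem LongBraidMove.symm {m : ℕ} {u v : List (Fin m)} (h : LongBraidMove u v) :
    LongBraidMove v u := by
  obtain ⟨p, q, j, k, hjk, hu, hv⟩ := h
  exact ⟨p, q, k, j, hjk.symm, hv, hu⟩

theorem LongBraidMove.ne {m : ℕ} {u v : List (Fin m)} (h : LongBraidMove u v) : u ≠ v := by
  obtain ⟨p, q, j, k, hjk, rfl, rfl⟩ := h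
  intro he
  simp only [List.append_assoc, List.append_cancel_left_eq, List.cons_append,
    List.cons.injEq] at he
  have := congrArg Fin.val he.1
  omega

/-- The graph on `R(π)` whose edges are the commutation edges only. -/
def commEdges {n : ℕ} (π : Equiv.Perm (Fin n)) : SimpleGraph (reducedWords π) where
  Adj u v := CommMove u.val v.val
  symm := ⟨fun _ _ h => h.symm⟩
  loopless := ⟨fun _ h => h.ne rfl⟩

/-- The graph on `R(π)` whose edges are the long braid edges only. -/
def braidEdges {n : ℕ} (π : Equiv.Perm (Fin n)) : SimpleGraph (reducedWords π) where
  Adj u v := LongBraidMove u.val v.val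
  symm := ⟨fun _ _ h => h.symm⟩
  loopless := ⟨fun _ h => h.ne rfl⟩

/-- `G_π`: the graph on `R(π)` whose edges are the commutation edges and the long braid edges. -/
def graphG {n : ℕ} (π : Equiv.Perm (Fin n)) : SimpleGraph (reducedWords π) :=
  commEdges π ⊔ braidEdges π

/-- The simple graph obtained from `G` by contracting the edges of `H`: its vertices are the
connected components of `H`, two different components being adjacent when some edge of `G`
joins them. -/
def contract {V : Type*} (G H : SimpleGraph V) : SimpleGraph H.ConnectedComponent where
  Adj S T := S ≠ T ∧
    ∃ u v : V, H.connectedComponentMk u = S ∧ H.connectedComponentMk v = T ∧ G.Adj u v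
  symm := ⟨fun _ _ ⟨hne, u, v, hu, hv, h⟩ => ⟨hne.symm, v, u, hv, hu, h.symm⟩⟩
  loopless := ⟨fun _ h => h.1 rfl⟩

/-- `C_π`: the graph `G_π` contracted along commutation edges; its vertices are the commutation
classes. -/
def graphC {n : ℕ} (π : Equiv.Perm (Fin n)) :
    SimpleGraph (commEdges π).ConnectedComponent :=
  contract (graphG π) (commEdges π)

/-- `B_π`: the graph `G_π` contracted along long braid edges; its vertices are the braid
classes. -/
def graphB {n : ℕ} (π : Equiv.Perm (Fin n)) :
    SimpleGraph (braidEdges π).ConnectedComponent :=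
  contract (graphG π) (braidEdges π)

/-- The inflation `21[α, β]`: the first `a` positions carry the values of `α` raised by `b`, the
last `b` positions carry the values of `β`. -/
def inflate21 {a b : ℕ} (α : Equiv.Perm (Fin a)) (β : Equiv.Perm (Fin b)) :
    Equiv.Perm (Fin (a + b)) :=
  finSumFinEquiv.symm.trans ((Equiv.sumCongr α β).trans
    ((Equiv.sumComm (Fin a) (Fin b)).trans (finSumFinEquiv.trans (finCongr (Nat.add_comm b a)))))

theorem inflate21_left {a b : ℕ} (α : Equiv.Perm (Fin a)) (β : Equiv.Perm (Fin b)) (i : Fin a) :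
    (inflate21 α β (Fin.castAdd b i)).val = (α i).val + b := by
  simp [inflate21]

theorem inflate21_right {a b : ℕ} (α : Equiv.Perm (Fin a)) (β : Equiv.Perm (Fin b)) (j : Fin b) :
    (inflate21 α β (Fin.natAdd a j)).val = (β j).val := by
  simp [inflate21]

end ReducedWords

/-! All three diameters come from one weighted distance on R(π), in which a commutation costs p and
a long braid move costs q: (p, q) is (1, 1) for G, (0, 1) for C and (1, 0) for B. With N =
C(a,2)·C(b,2), the weighted diameter of π lies between D + ℓ(α)b((a-2)p + q) + pN and the same
expression with 2pN, where D is that of α (`weightedDiam_inflate21`). For p = 0 the two bounds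
coincide, which gives (ii).

A reduced word is a wiring diagram. Each letter crosses two adjacent strands x < y, and the word is
recorded by the list of labels (x, y). Commutations exchange adjacent disjoint labels; braid moves
reverse a block (x,y), (x,z), (y,z). For π, the b small strands never cross one another, each
crosses all a large strands once, and the large strands form a diagram of α.

Upper bound: the small strands are pulled one at a time behind all other crossings
(`Sorts.remove_head`, `Sorts.remove_prefix`), at a cost that is a sum over the wrongly ordered pairs
of labels. Pulling a small strand entirely across one large crossing takes one braid move and a-2
commutations. By reversal, the large crossings can instead be put last. Over these two normal forms
together, a pair of a small and a large label is paid once, and a wrongly ordered pair of small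
labels twice. The latter contribute at most pN each time, because small strands never overtake one
another (`Sorts.pairSum_smallWeight_le`). Two words are joined through either normal form, and the
cheaper route costs at most the average.

Lower bound: the same sum over wrongly ordered pairs is a potential that no move changes by more
than its cost, and that moves among large labels do not change (`LabelReach.exists_large`). A path
for π therefore pays for its projection to α and, in addition, for the potential difference of its
ends. -/

namespace ReducedWords

/-! ### Weighted paths -/

/-- `Reach r s p q u v c`: there is a path from `u` to `v` of total cost `c`, where an `r`-step
costs `p` and an `s`-step costs `q`. -/
inductive Reach {V : Type*} (r s : V → V → Prop) (p q : ℕ) : V → V → ℕ → Prop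
  | refl (u : V) : Reach r s p q u u 0
  | fst {u v w : V} {c : ℕ} : r u v → Reach r s p q v w c → Reach r s p q u w (p + c)
  | snd {u v w : V} {c : ℕ} : s u v → Reach r s p q v w c → Reach r s p q u w (q + c)

namespace Reach

variable {V W : Type*} {r s : V → V → Prop} {r' s' : W → W → Prop} {p q : ℕ}

theorem trans {u v w : V} {c d : ℕ} (h : Reach r s p q u v c) (h' : Reach r s p q v w d) :
    Reach r s p q u w (c + d) := by
  induction h with
  | refl u => simpa using h'
  | fst h1 _ ih => rw [add_assoc]; exact .fst h1 (ih h')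
  | snd h1 _ ih => rw [add_assoc]; exact .snd h1 (ih h')

theorem single_fst {u v : V} (h : r u v) : Reach r s p q u v p := .fst h (.refl v)

theorem single_snd {u v : V} (h : s u v) : Reach r s p q u v q := .snd h (.refl v)

theorem symm (hr : ∀ u v, r u v → r v u) (hs : ∀ u v, s u v → s v u) {u v : V} {c : ℕ}
    (h : Reach r s p q u v c) : Reach r s p q v u c := by
  induction h with
  | refl u => exact .refl u
  | fst h1 _ ih => rw [add_comm]; exact ih.trans (single_fst (hr _ _ h1))
  | snd h1 _ ih => rw [add_comm]; exact ih.trans (single_snd (hs _ _ h1))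

theorem map (φ : V → W) (hr : ∀ u v, r u v → r' (φ u) (φ v)) (hs : ∀ u v, s u v → s' (φ u) (φ v))
    {u v : V} {c : ℕ} (h : Reach r s p q u v c) : Reach r' s' p q (φ u) (φ v) c := by
  induction h with
  | refl u => exact .refl _
  | fst h1 _ ih => exact .fst (hr _ _ h1) ih
  | snd h1 _ ih => exact .snd (hs _ _ h1) ih

end Reach

/-! ### Sums over ordered pairs of list entries -/

/-- The sum of `g x y` over all pairs of entries `x`, `y` of the list with `x` before `y`. -/
def pairSum {T : Type*} (g : T → T → ℕ) : List T → ℕ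
  | [] => 0
  | x :: l => (l.map (g x)).sum + pairSum g l

section PairSum

variable {T : Type*} (g g' : T → T → ℕ)

theorem pairSum_append (l m : List T) :
    pairSum g (l ++ m) = pairSum g l + pairSum g m + (l.map fun x => (m.map (g x)).sum).sum := by
  induction l with
  | nil => simp [pairSum]
  | cons x l ih => simp only [List.cons_append, pairSum, ih, List.map_append, List.sum_append,
      List.map_cons, List.sum_cons]; ring

theorem pairSum_concat (l : List T) (y : T) :
    pairSum g (l ++ [y]) = pairSum g l + (l.map fun x => g x y).sum := by
  simp [pairSum_append, pairSum]

theorem pairSum_reverse (l : List T) :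
    pairSum g l.reverse = pairSum (fun x y => g y x) l := by
  induction l with
  | nil => rfl
  | cons x l ih =>
    rw [List.reverse_cons, pairSum_concat, ih, pairSum, List.map_reverse, List.sum_reverse]
    ring

theorem pairSum_add (l : List T) :
    pairSum (fun x y => g x y + g' x y) l = pairSum g l + pairSum g' l := by
  induction l with
  | nil => rfl
  | cons x l ih => simp only [pairSum, ih, List.sum_map_add]; ring

variable {g g'}

theorem pairSum_congr {l : List T} (h : ∀ x ∈ l, ∀ y ∈ l, g x y = g' x y) :
    pairSum g l = pairSum g' l := by
  induction l with
  | nil => rfl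
  | cons x l ih =>
    simp only [pairSum]
    rw [ih fun x hx y hy => h x (by simp [hx]) y (by simp [hy])]
    congr 2
    exact List.map_congr_left fun y hy => h x (by simp) y (by simp [hy])

theorem pairSum_eq_zero {l : List T} (h : l.Pairwise fun x y => g x y = 0) :
    pairSum g l = 0 := by
  induction l with
  | nil => rfl
  | cons x l ih =>
    rw [List.pairwise_cons] at h
    simp only [pairSum, ih h.2, add_zero]
    exact List.sum_eq_zero (by simpa using h.1)

/-- Deleting entries amounts to setting weights to zero, so costs on a sublist and on the full list
can be added pair by pair. -/
theorem pairSum_filter (t : T → Bool) (l : List T) :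
    pairSum g (l.filter t) = pairSum (fun x y => if t x ∧ t y then g x y else 0) l := by
  induction l with
  | nil => rfl
  | cons x l ih =>
    have hs : ∀ m : List T, ((m.filter t).map (g x)).sum =
        (m.map fun y => if t y then g x y else 0).sum := by
      intro m
      induction m with
      | nil => rfl
      | cons y m ihm => by_cases hy : t y <;> simp [hy, ihm]
    by_cases hx : t x
    · simp [pairSum, hx, ih, hs]
    · simp [pairSum, hx, ih]

theorem pairSum_perm (hg : ∀ x y, g x y = g y x) {l m : List T} (h : l.Perm m) :
    pairSum g l = pairSum g m := by
  induction h with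
  | nil => rfl
  | cons x h ih => simp only [pairSum, ih, (h.map (g x)).sum_eq]
  | swap x y l => simp only [pairSum, List.map_cons, List.sum_cons, hg x y]; ring
  | trans _ _ ih1 ih2 => exact ih1.trans ih2

end PairSum

/-! ### Label lists -/

/-- `Sorts A L B`: the list `A` is transformed into `B` by interchanging adjacent entries `x < y`
step by step, `L` being the list of the pairs `(x, y)`. -/
inductive Sorts : List ℕ → List (ℕ × ℕ) → List ℕ → Prop
  | nil (A : List ℕ) : Sorts A [] A
  | cons {P : List ℕ} {x y : ℕ} {Q : List ℕ} {L : List (ℕ × ℕ)} {B : List ℕ} : x < y →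
      Sorts (P ++ y :: x :: Q) L B → Sorts (P ++ x :: y :: Q) ((x, y) :: L) B

/-- Two adjacent labels without common entry are interchanged. -/
def LabelComm (L M : List (ℕ × ℕ)) : Prop :=
  ∃ X Y l m, (l.1 ≠ m.1 ∧ l.1 ≠ m.2 ∧ l.2 ≠ m.1 ∧ l.2 ≠ m.2) ∧
    L = X ++ [l, m] ++ Y ∧ M = X ++ [m, l] ++ Y

/-- The three labels of a triple, on consecutive positions, are reversed. -/
def LabelBraid (L M : List (ℕ × ℕ)) : Prop :=
  ∃ X Y x y z, x < y ∧ y < z ∧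
    ((L = X ++ [(x, y), (x, z), (y, z)] ++ Y ∧ M = X ++ [(y, z), (x, z), (x, y)] ++ Y) ∨
     (M = X ++ [(x, y), (x, z), (y, z)] ++ Y ∧ L = X ++ [(y, z), (x, z), (x, y)] ++ Y))

theorem LabelComm.symm {L M : List (ℕ × ℕ)} (h : LabelComm L M) : LabelComm M L := by
  obtain ⟨X, Y, l, m, h, rfl, rfl⟩ := h
  exact ⟨X, Y, m, l, ⟨h.1.symm, h.2.2.1.symm, h.2.1.symm, h.2.2.2.symm⟩, rfl, rfl⟩

theorem LabelBraid.symm {L M : List (ℕ × ℕ)} (h : LabelBraid L M) : LabelBraid M L := by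
  obtain ⟨X, Y, x, y, z, h1, h2, h⟩ := h
  exact ⟨X, Y, x, y, z, h1, h2, h.symm⟩

/-- Weighted paths of label lists. -/
abbrev LabelReach (p q : ℕ) : List (ℕ × ℕ) → List (ℕ × ℕ) → ℕ → Prop :=
  Reach LabelComm LabelBraid p q

namespace LabelReach

variable {p q : ℕ} {L M : List (ℕ × ℕ)} {c : ℕ}

theorem symm (h : LabelReach p q L M c) : LabelReach p q M L c :=
  Reach.symm (fun _ _ => LabelComm.symm) (fun _ _ => LabelBraid.symm) h

theorem append (h : LabelReach p q L M c) (X Y : List (ℕ × ℕ)) :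
    LabelReach p q (X ++ L ++ Y) (X ++ M ++ Y) c := by
  refine Reach.map (fun L => X ++ L ++ Y) ?_ ?_ h
  · rintro _ _ ⟨X', Y', l, m, h, rfl, rfl⟩
    exact ⟨X ++ X', Y' ++ Y, l, m, h, by simp, by simp⟩
  · rintro _ _ ⟨X', Y', x, y, z, h1, h2, ⟨rfl, rfl⟩ | ⟨rfl, rfl⟩⟩
    · exact ⟨X ++ X', Y' ++ Y, x, y, z, h1, h2, .inl ⟨by simp, by simp⟩⟩
    · exact ⟨X ++ X', Y' ++ Y, x, y, z, h1, h2, .inr ⟨by simp, by simp⟩⟩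

theorem append_right (h : LabelReach p q L M c) (Y : List (ℕ × ℕ)) :
    LabelReach p q (L ++ Y) (M ++ Y) c := h.append [] Y

theorem append_left (h : LabelReach p q L M c) (X : List (ℕ × ℕ)) :
    LabelReach p q (X ++ L) (X ++ M) c := by simpa using h.append X []

theorem reverse (h : LabelReach p q L M c) : LabelReach p q L.reverse M.reverse c := by
  refine Reach.map List.reverse ?_ ?_ h
  · rintro _ _ ⟨X, Y, l, m, h, rfl, rfl⟩
    exact ⟨Y.reverse, X.reverse, m, l, ⟨h.1.symm, h.2.2.1.symm, h.2.1.symm, h.2.2.2.symm⟩,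
      by simp, by simp⟩
  · rintro _ _ ⟨X, Y, x, y, z, h1, h2, ⟨rfl, rfl⟩ | ⟨rfl, rfl⟩⟩
    · exact ⟨Y.reverse, X.reverse, x, y, z, h1, h2, .inr ⟨by simp, by simp⟩⟩
    · exact ⟨Y.reverse, X.reverse, x, y, z, h1, h2, .inl ⟨by simp, by simp⟩⟩

theorem perm (h : LabelReach p q L M c) : L.Perm M := by
  induction h with
  | refl => rfl
  | fst h _ ih =>
    obtain ⟨X, Y, l, m, -, rfl, rfl⟩ := h
    refine List.Perm.trans ?_ ih
    exact ((List.Perm.swap _ _ _).append_left X).append_right Y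
  | snd h _ ih =>
    obtain ⟨X, Y, x, y, z, -, -, ⟨rfl, rfl⟩ | ⟨rfl, rfl⟩⟩ := h
    · refine List.Perm.trans ?_ ih
      exact ((List.reverse_perm [(y, z), (x, z), (x, y)]).append_left X).append_right Y
    · refine List.Perm.trans ?_ ih
      exact ((List.reverse_perm [(x, y), (x, z), (y, z)]).append_left X).append_right Y

end LabelReach

namespace Sorts

variable {A B C : List ℕ} {L M : List (ℕ × ℕ)}

theorem trans (h : Sorts A L B) (h' : Sorts B M C) : Sorts A (L ++ M) C := by
  induction h with
  | nil => exact h'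
  | cons hxy _ ih => exact .cons hxy (ih h')

theorem single (P : List ℕ) {x y : ℕ} (h : x < y) (Q : List ℕ) :
    Sorts (P ++ x :: y :: Q) [(x, y)] (P ++ y :: x :: Q) := .cons h (.nil _)

theorem of_append (h : Sorts A (L ++ M) B) : ∃ C, Sorts A L C ∧ Sorts C M B := by
  induction L generalizing A with
  | nil => exact ⟨A, .nil A, h⟩
  | cons l L ih =>
    cases h with
    | cons hxy h =>
      obtain ⟨C, h1, h2⟩ := ih h
      exact ⟨C, .cons hxy h1, h2⟩

theorem eq_of_nil (h : Sorts A [] B) : A = B := by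
  cases h; rfl

theorem of_singleton {l : ℕ × ℕ} (h : Sorts A [l] B) : ∃ P Q, l.1 < l.2 ∧
    A = P ++ l.1 :: l.2 :: Q ∧ B = P ++ l.2 :: l.1 :: Q := by
  cases h with
  | cons hxy h => exact ⟨_, _, hxy, rfl, h.eq_of_nil.symm⟩

theorem perm (h : Sorts A L B) : A.Perm B := by
  induction h with
  | nil => rfl
  | cons _ _ ih => exact ((List.Perm.swap _ _ _).append_left _).trans ih

theorem lt_and_mem (h : Sorts A L B) : ∀ l ∈ L, l.1 < l.2 ∧ l.1 ∈ A ∧ l.2 ∈ A := by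
  induction h with
  | nil => simp
  | @cons P x y Q L B hxy h ih =>
    intro l hl
    rcases List.mem_cons.1 hl with rfl | hl
    · simp [hxy]
    · obtain ⟨h1, h2, h3⟩ := ih l hl
      refine ⟨h1, ?_, ?_⟩
      · simp only [List.mem_append, List.mem_cons] at h2 ⊢; tauto
      · simp only [List.mem_append, List.mem_cons] at h3 ⊢; tauto

theorem append (h : Sorts A L B) (X Y : List ℕ) : Sorts (X ++ A ++ Y) L (X ++ B ++ Y) := by
  induction h with
  | nil => exact .nil _
  | @cons P x y Q L B hxy h ih =>
    have := Sorts.cons (P := X ++ P) (Q := Q ++ Y) (L := L) (B := X ++ B ++ Y) hxy (by simpa using ih)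
    simpa using this

theorem append_left (h : Sorts A L B) (X : List ℕ) : Sorts (X ++ A) L (X ++ B) := by
  simpa using h.append X []

theorem append_right (h : Sorts A L B) (Y : List ℕ) : Sorts (A ++ Y) L (B ++ Y) := by
  simpa using h.append [] Y

theorem reverse (h : Sorts A L B) : Sorts B.reverse L.reverse A.reverse := by
  induction h with
  | nil => exact .nil _
  | @cons P x y Q L B hxy h ih =>
    rw [List.reverse_cons]
    refine ih.trans ?_
    simpa using Sorts.single Q.reverse hxy P.reverse

theorem filter (t : ℕ → Bool) (h : Sorts A L B) :
    Sorts (A.filter t) (L.filter fun l => t l.1 && t l.2) (B.filter t) := by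
  induction h with
  | nil => exact .nil _
  | @cons P x y Q L B hxy h ih =>
    by_cases hx : t x <;> by_cases hy : t y
    · simp only [List.filter_append, List.filter_cons, hx, hy] at ih ⊢
      exact .cons hxy ih
    all_goals simpa [List.filter_cons, hx, hy] using ih

end Sorts

/-! ### Moving one strand to the end -/

/-- The cost of moving the label `m` to the left across the label `l`, where `l.1` does not occur
in `m`. -/
def labelWeight (p q : ℕ) (l m : ℕ × ℕ) : ℕ :=
  -- A crossing (x, y) passes (z, x) and (z, y) together in a single braid move, so q is charged to
  -- (z, x) and nothing to (z, y).
  if l.2 = m.1 then q else if l.2 = m.2 then 0 else p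

theorem Sorts.column {z : ℕ} {P : List ℕ} (h : ∀ x ∈ P, z < x) (Q : List ℕ) :
    Sorts (z :: P ++ Q) (P.map (Prod.mk z)) (P ++ z :: Q) := by
  induction P with
  | nil => exact .nil _
  | cons x P ih =>
    have h1 := (ih fun y hy => h y (by simp [hy])).append_left [x]
    exact .cons (P := []) (h x (by simp)) (by simpa using h1)

theorem reach_push_left (p q : ℕ) {z : ℕ} {m : ℕ × ℕ} {P : List ℕ} (h1 : m.1 ≠ z) (h2 : m.2 ≠ z)
    (hP1 : m.1 ∉ P) (hP2 : m.2 ∉ P) :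
    LabelReach p q (P.map (Prod.mk z) ++ [m]) (m :: P.map (Prod.mk z)) (P.length * p) := by
  induction P with
  | nil => simpa using Reach.refl [m]
  | cons x P ih =>
    simp only [List.mem_cons, not_or] at hP1 hP2
    have h3 := LabelReach.append_left (ih hP1.2 hP2.2) [(z, x)]
    have h4 : LabelComm ((z, x) :: m :: P.map (Prod.mk z)) (m :: (z, x) :: P.map (Prod.mk z)) :=
      ⟨[], P.map (Prod.mk z), (z, x), m, ⟨h1.symm, h2.symm, Ne.symm hP1.1, Ne.symm hP2.1⟩, rfl, rfl⟩
    have h5 := h3.trans (.single_fst h4)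
    rw [List.length_cons, add_mul, one_mul]
    exact h5

/-- The new crossing commutes past the labels of `Q`, passes (z, x) and (z, y) by one braid move,
which exchanges them, and then commutes past the labels of `P`. -/
theorem reach_push_left_braid (p q : ℕ) {z x y : ℕ} {P Q : List ℕ} (hzx : z < x) (hxy : x < y)
    (hP : (P ++ x :: y :: Q).Nodup) :
    LabelReach p q ((P ++ x :: y :: Q).map (Prod.mk z) ++ [(x, y)])
      ((x, y) :: (P ++ y :: x :: Q).map (Prod.mk z)) (P.length * p + q + Q.length * p) := by
  have hxP : x ∉ P ∧ y ∉ P ∧ x ∉ Q ∧ y ∉ Q := by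
    simp only [List.nodup_append, List.nodup_cons, List.mem_cons, not_or] at hP
    refine ⟨fun h => hP.2.2 x h x (by simp) rfl, fun h => hP.2.2 y h y (by simp) rfl, ?_, ?_⟩ <;>
    tauto
  have h1 := LabelReach.append_left (reach_push_left p q (z := z) (m := (x, y)) (P := Q)
    (by simp; omega) (by simp; omega) hxP.2.2.1 hxP.2.2.2) (P.map (Prod.mk z) ++ [(z, x), (z, y)])
  have h2 : LabelBraid (P.map (Prod.mk z) ++ [(z, x), (z, y), (x, y)] ++ Q.map (Prod.mk z))
      (P.map (Prod.mk z) ++ [(x, y), (z, y), (z, x)] ++ Q.map (Prod.mk z)) :=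
    ⟨_, _, z, x, y, hzx, hxy, .inl ⟨rfl, rfl⟩⟩
  have h3 := LabelReach.append_right (reach_push_left p q (z := z) (m := (x, y)) (P := P)
    (by simp; omega) (by simp; omega) hxP.1 hxP.2.1) ([(z, y), (z, x)] ++ Q.map (Prod.mk z))
  have h4 := (Reach.single_snd (r := LabelComm) (p := p) (q := q) h2).trans
    (by simpa using h3)
  have h5 := h1.trans (by simpa using h4)
  rw [show P.length * p + q + Q.length * p = Q.length * p + (q + P.length * p) by ring]
  simpa using h5

theorem sum_labelWeight_of_notMem (p q z : ℕ) {m : ℕ × ℕ} {P : List ℕ}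
    (hP1 : m.1 ∉ P) (hP2 : m.2 ∉ P) :
    (P.map fun x => labelWeight p q (z, x) m).sum = P.length * p := by
  have : P.map (fun x => labelWeight p q (z, x) m) = P.map fun _ => p := by
    refine List.map_congr_left fun x hx => ?_
    have h1 : x ≠ m.1 := fun h => hP1 (h ▸ hx)
    have h2 : x ≠ m.2 := fun h => hP2 (h ▸ hx)
    simp [labelWeight, h1, h2]
  simp [this]

theorem sum_labelWeight_of_nodup (p q z : ℕ) {x y : ℕ} {P Q : List ℕ}
    (hP : (P ++ x :: y :: Q).Nodup) :
    ((P ++ x :: y :: Q).map fun x' => labelWeight p q (z, x') (x, y)).sum =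
      P.length * p + q + Q.length * p := by
  have hxP : (x ∉ P ∧ y ∉ P) ∧ (x ∉ Q ∧ y ∉ Q) ∧ y ≠ x := by
    simp only [List.nodup_append, List.nodup_cons, List.mem_cons, not_or] at hP
    refine ⟨⟨fun h => hP.2.2 x h x (by simp) rfl, fun h => hP.2.2 y h y (by simp) rfl⟩, ?_⟩
    tauto
  rw [List.map_append, List.sum_append, List.map_cons, List.map_cons, List.sum_cons,
    List.sum_cons, sum_labelWeight_of_notMem p q z hxP.1.1 hxP.1.2,
    sum_labelWeight_of_notMem p q z hxP.2.1.1 hxP.2.1.2]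
  simp [labelWeight, hxP.2.2]
  ring

/-- The strand `z` at the head of the list can be made to move last. -/
theorem Sorts.remove_head (p q : ℕ) {z : ℕ} {A S : List ℕ} {L : List (ℕ × ℕ)}
    (hA : (z :: A).Nodup) (h : Sorts (z :: A) L S) :
    ∃ P Q, S = P ++ z :: Q ∧ (∀ x ∈ P, z < x) ∧
      LabelReach p q L ((L.filter fun l => l.1 != z && l.2 != z) ++ P.map (Prod.mk z))
        (pairSum (fun l m => if l.1 = z ∧ m.1 ≠ z then labelWeight p q l m else 0) L) := by
  -- By induction the earlier crossings of `z` already form a final column over `P`, the strands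
  -- passed so far. Only the last crossing has to be moved left across that column.
  induction L using List.reverseRecOn generalizing S with
  | nil => exact ⟨[], A, h.eq_of_nil.symm, by simp, Reach.refl _⟩
  | append_singleton L l ih =>
    obtain ⟨C, h1, h2⟩ := h.of_append
    obtain ⟨P, Q, hC, hP, hR⟩ := ih h1
    obtain ⟨P1, Q1, hl, hC', hS⟩ := h2.of_singleton
    obtain ⟨x, y⟩ := l
    dsimp only at hl hC' hS
    have hnd : C.Nodup := h1.perm.nodup_iff.1 hA
    rw [pairSum_concat]
    -- The weight sum does not depend on the order, so it may be computed on the rearranged list,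
    -- where only the column of `z` contributes.
    have hsum : (L.map fun l => if l.1 = z ∧ (x, y).1 ≠ z then labelWeight p q l (x, y) else 0).sum
        = if x = z then 0 else (P.map fun x' => labelWeight p q (z, x') (x, y)).sum := by
      rw [(hR.perm.map _).sum_eq, List.map_append, List.sum_append, List.sum_eq_zero, zero_add]
      · split_ifs with hx
        · exact List.sum_eq_zero (by simp [hx])
        · simp [hx, Function.comp_def]
      · intro n hn
        obtain ⟨l, hl, rfl⟩ := List.mem_map.1 hn
        have := (List.mem_filter.1 hl).2
        simp only [Bool.and_eq_true, bne_iff_ne] at this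
        simp [this.1]
    rw [hsum, List.filter_append]
    have hR' := hR.append_right [(x, y)]
    -- the three possible places of the last crossing relative to `z`
    have hcase : (x = z ∧ P1 = P ∧ Q = y :: Q1) ∨ (∃ D, P1 = P ++ z :: D ∧ Q = D ++ x :: y :: Q1) ∨
        (∃ D, P = P1 ++ x :: y :: D ∧ Q1 = D ++ z :: Q) := by
      rw [hC] at hC'
      rcases List.append_eq_append_iff.1 hC' with ⟨D, h3, h4⟩ | ⟨D, h3, h4⟩
      · rcases D with _ | ⟨d, D⟩
        · left; simp at h3 h4; exact ⟨h4.1.symm, h3, h4.2⟩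
        · right; left
          simp only [List.cons_append, List.cons.injEq] at h4
          obtain ⟨rfl, h4⟩ := h4
          exact ⟨D, h3, h4⟩
      · rcases D with _ | ⟨d, _ | ⟨e, D⟩⟩
        · left; simp at h3 h4; exact ⟨h4.1, h3.symm, h4.2.symm⟩
        · simp only [List.cons_append, List.nil_append, List.cons.injEq] at h4
          obtain ⟨rfl, rfl, -⟩ := h4
          -- Here `z` would be the larger strand of the crossing, which is impossible since every
          -- strand to its left is larger than `z`.
          have := hP x (by simp [h3])
          omega
        · right; right
          simp only [List.cons_append, List.cons.injEq] at h4
          obtain ⟨rfl, rfl, h4⟩ := h4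
          exact ⟨D, h3, h4⟩
    rcases hcase with ⟨rfl, rfl, rfl⟩ | ⟨D, rfl, rfl⟩ | ⟨D, rfl, rfl⟩
    · refine ⟨P1 ++ [y], Q1, by simp [hS], ?_, ?_⟩
      · intro w hw
        rcases List.mem_append.1 hw with hw | hw
        · exact hP w hw
        · simp at hw; omega
      · simpa using hR'
    · have hx : x ∉ P ∧ y ∉ P ∧ x ≠ z ∧ y ≠ z := by
        rw [hC] at hnd
        simp only [List.nodup_append, List.nodup_cons, List.mem_cons, List.mem_append, not_or] at hnd
        refine ⟨fun h => hnd.2.2 x h x (by simp) rfl, fun h => hnd.2.2 y h y (by simp) rfl, ?_⟩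
        exact ⟨Ne.symm hnd.2.1.1.2.1, Ne.symm hnd.2.1.1.2.2.1⟩
      refine ⟨P, D ++ y :: x :: Q1, by simp [hS], hP, ?_⟩
      rw [if_neg hx.2.2.1, sum_labelWeight_of_notMem p q z hx.1 hx.2.1]
      have h5 := LabelReach.append_left (reach_push_left p q (z := z) (m := (x, y)) (P := P)
        hx.2.2.1 hx.2.2.2 hx.1 hx.2.1) (L.filter fun l => l.1 != z && l.2 != z)
      have h6 := hR'.trans (by simpa using h5)
      simpa [hx.2.2.1, hx.2.2.2] using h6
    · have hzx : z < x := hP x (by simp)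
      have hzy : z < y := hP y (by simp)
      have hPn : (P1 ++ x :: y :: D).Nodup := by
        rw [hC] at hnd
        exact (List.nodup_append.1 hnd).1
      refine ⟨P1 ++ y :: x :: D, Q, by simp [hS], ?_, ?_⟩
      · intro w hw
        refine hP w ?_
        simp only [List.mem_append, List.mem_cons] at hw ⊢
        tauto
      rw [if_neg hzx.ne', sum_labelWeight_of_nodup p q z hPn]
      have h5 := LabelReach.append_left (reach_push_left_braid p q hzx hl hPn)
        (L.filter fun l => l.1 != z && l.2 != z)
      have h6 := hR'.trans (by simpa only [List.append_assoc] using h5)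
      simpa [hzx.ne', hzy.ne'] using h6

theorem append_cons_inj_of_nodup {z : ℕ} {P Q P' Q' : List ℕ} (h : (P ++ z :: Q).Nodup)
    (he : P ++ z :: Q = P' ++ z :: Q') : P = P' ∧ Q = Q' := by
  have key : ∀ P Q : List ℕ, (P ++ z :: Q).Nodup → z ∉ P := fun P Q h hz =>
    (List.nodup_append.1 h).2.2 z hz z (by simp) rfl
  have hP := key P Q h
  have hP' := key P' Q' (he ▸ h)
  rcases List.append_eq_append_iff.1 he with ⟨D, rfl, h4⟩ | ⟨D, rfl, h4⟩
  · rcases D with _ | ⟨d, D⟩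
    · simpa using h4
    · simp_all
  · rcases D with _ | ⟨d, D⟩
    · simpa using h4.symm
    · simp_all

theorem filter_ne_of_nodup {z : ℕ} {P Q : List ℕ} (h : (P ++ z :: Q).Nodup) :
    (P ++ z :: Q).filter (· != z) = P ++ Q := by
  have h1 : z ∉ P ∧ z ∉ Q := by
    simp only [List.nodup_append, List.nodup_cons, List.mem_cons] at h
    exact ⟨fun hz => h.2.2 z hz z (by simp) rfl, h.2.1.1⟩
  rw [List.filter_append, List.filter_cons, List.filter_eq_self.2, List.filter_eq_self.2]
  · simp
  · intro x hx; simpa using ne_of_mem_of_not_mem hx h1.2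
  · intro x hx; simpa using ne_of_mem_of_not_mem hx h1.1

theorem Sorts.filter_head {z : ℕ} {A P Q : List ℕ} {L : List (ℕ × ℕ)}
    (hA : (z :: A).Nodup) (h : Sorts (z :: A) L (P ++ z :: Q)) :
    Sorts A (L.filter fun l => l.1 != z && l.2 != z) (P ++ Q) := by
  have h1 := h.filter (· != z)
  rwa [filter_ne_of_nodup (h.perm.nodup_iff.1 hA), show z :: A = [] ++ z :: A from rfl,
    filter_ne_of_nodup hA, List.nil_append] at h1

/-- Any two label lists between the same lists are connected by moves. -/
theorem Sorts.exists_reach (p q : ℕ) {A B : List ℕ} {L M : List (ℕ × ℕ)} (hA : A.Nodup)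
    (hL : Sorts A L B) (hM : Sorts A M B) : ∃ c, LabelReach p q L M c := by
  induction A generalizing B L M with
  | nil =>
    have key : ∀ N, Sorts [] N B → N = [] := by
      intro N hN
      rcases N with _ | ⟨n, N⟩
      · rfl
      · simpa using (hN.lt_and_mem n (by simp)).2.1
    rw [key L hL, key M hM]
    exact ⟨0, .refl _⟩
  | cons z A ih =>
    -- In both lists `z` is made to move last. The place of `z` in the target list determines the
    -- column, so only the lists without `z` remain to be connected.
    obtain ⟨P, Q, rfl, -, h1⟩ := hL.remove_head p q hA
    obtain ⟨P', Q', hS, -, h2⟩ := hM.remove_head p q hA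
    have hnd : (P ++ z :: Q).Nodup := hL.perm.nodup_iff.1 hA
    obtain rfl : P = P' := (append_cons_inj_of_nodup hnd hS).1
    obtain ⟨c, hc⟩ := ih (List.nodup_cons.1 hA).2 (hL.filter_head hA) (hM.filter_head hA)
    exact ⟨_, (h1.trans (hc.append_right _)).trans h2.symm⟩

/-! ### Moving a block of strands to the end -/

/-- The labels of the crossings of the strands `Z` with the strands `B`, the last strand of `Z`
moving first. -/
def columns (Z B : List ℕ) : List (ℕ × ℕ) := Z.reverse.flatMap fun z => B.map (Prod.mk z)

/-- The weight of the pair of labels `l`, `m` when `l` stands before `m` although the strand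
`l.1 ∈ Z` should move after the strands of `m`; the strands are ranked by `r`. -/
def crossWeight (p q : ℕ) (Z : List ℕ) (r : ℕ → ℕ) (l m : ℕ × ℕ) : ℕ :=
  if l.1 ∈ Z ∧ r l.1 < r m.1 then labelWeight p q l m else 0

/-- Iteration of `Sorts.remove_head`: removing the head `z` pays for the pairs led by a label of
`z`, and the remaining pairs are paid in the list without `z`. The rank `r` records the order of
removal, which need not be the order of the values: in the reversed diagram the small strands stand
in decreasing order. -/
theorem Sorts.remove_prefix (p q : ℕ) {Z A B : List ℕ} {L : List (ℕ × ℕ)} {r : ℕ → ℕ}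
    (hA : (Z ++ A).Nodup) (h : Sorts (Z ++ A) L (B ++ Z)) (hr : Z.Pairwise fun s t => r s < r t)
    (hrA : ∀ z ∈ Z, ∀ x ∈ A, r z < r x) :
    LabelReach p q L ((L.filter fun l => decide (l.1 ∉ Z) && decide (l.2 ∉ Z)) ++ columns Z B)
      (pairSum (crossWeight p q Z r) L) ∧ ∀ z ∈ Z, ∀ x ∈ B, z < x := by
  induction Z generalizing L with
  | nil =>
    have h0 : pairSum (crossWeight p q [] r) L = 0 := by
      rw [pairSum_congr (g' := fun _ _ => 0) (by simp [crossWeight])]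
      exact pairSum_eq_zero (List.pairwise_of_forall fun _ _ => rfl)
    rw [h0]
    simpa [columns] using Reach.refl L
  | cons z Z ih =>
    obtain ⟨P, Q, hS, hP, hR⟩ := Sorts.remove_head p q hA h
    obtain ⟨rfl, rfl⟩ := append_cons_inj_of_nodup (h.perm.nodup_iff.1 hA) hS
    rw [List.pairwise_cons] at hr
    obtain ⟨ih1, ih2⟩ := ih (List.nodup_cons.1 hA).2 (h.filter_head hA) hr.2
      fun s hs => hrA s (by simp [hs])
    refine ⟨?_, ?_⟩
    -- Since `z` has the least rank and is never the larger entry of a label, for a label `m` the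
    -- condition `m.1 ≠ z` amounts to `r z < r m.1`. This identifies the cost of one removal with a
    -- part of `crossWeight`.
    · have hlab : ∀ l ∈ L, l.2 ≠ z ∧ (l.1 = z ∨ r z < r l.1) := by
        intro l hl
        constructor
        · have := (hR.perm.mem_iff).1 hl
          simp only [List.mem_append, List.mem_filter, Bool.and_eq_true, bne_iff_ne,
            List.mem_map] at this
          rcases this with h | ⟨x, hx, rfl⟩
          · exact h.2.2
          · exact (hP x hx).ne'
        · have := (h.lt_and_mem l hl).2.1
          simp only [List.cons_append, List.mem_cons, List.mem_append] at this
          rcases this with h | h | h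
          · exact .inl h
          · exact .inr (hr.1 _ h)
          · exact .inr (hrA z (by simp) _ h)
      have hsum := pairSum_filter (g := crossWeight p q Z r) (fun l => l.1 != z && l.2 != z) L
      have htot := hR.trans (ih1.append_right _)
      rw [hsum, ← pairSum_add, pairSum_congr (g' := crossWeight p q (z :: Z) r)] at htot
      · convert htot using 1
        rw [List.filter_filter, columns, columns, List.reverse_cons, List.flatMap_append,
          List.append_assoc]
        congr 1
        · refine List.filter_congr fun l _ => ?_
          by_cases h1 : l.1 = z <;> by_cases h2 : l.2 = z <;> simp [h1, h2]
        · simp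
      · intro l hl m hm
        have h1 := hlab l hl
        have h2 := hlab m hm
        simp only [crossWeight, List.mem_cons]
        by_cases hlz : l.1 = z
        · by_cases hmz : m.1 = z
          · simp [hlz, hmz]
          · simp [hlz, hmz, h2.2.resolve_left hmz]
        · by_cases hmz : m.1 = z
          · have := h1.2.resolve_left hlz
            simp [hlz, hmz, this.le]
          · simp [hlz, hmz, h1.1, h2.1]
    · intro s hs x hx
      rcases List.mem_cons.1 hs with rfl | hs
      · exact hP x hx
      · exact ih2 s hs x hx

theorem Sorts.columns {Z B : List ℕ} (h : ∀ z ∈ Z, ∀ x ∈ B, z < x) :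
    Sorts (Z ++ B) (columns Z B) (B ++ Z) := by
  induction Z with
  | nil => simpa [ReducedWords.columns] using Sorts.nil B
  | cons z Z ih =>
    have h1 := (ih fun s hs => h s (by simp [hs])).append_left [z]
    have h2 := h1.trans (by simpa using Sorts.column (h z (by simp)) Z)
    simpa [ReducedWords.columns] using h2

/-- The labels of the crossings of the strands `Z` with the strands `A`, the first strand of `A`
moving first. -/
def rows (Z A : List ℕ) : List (ℕ × ℕ) := A.flatMap fun x => Z.reverse.map fun z => (z, x)

theorem Sorts.row {Z : List ℕ} {x : ℕ} (h : ∀ z ∈ Z, z < x) :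
    Sorts (Z ++ [x]) (Z.reverse.map fun z => (z, x)) (x :: Z) := by
  induction Z with
  | nil => exact .nil _
  | cons z Z ih =>
    have h1 := (ih fun s hs => h s (by simp [hs])).append_left [z]
    have h2 := h1.trans (Sorts.single [] (h z (by simp)) Z)
    simpa using h2

theorem Sorts.rows {Z A : List ℕ} (h : ∀ z ∈ Z, ∀ x ∈ A, z < x) :
    Sorts (Z ++ A) (rows Z A) (A ++ Z) := by
  induction A with
  | nil => simpa [ReducedWords.rows] using Sorts.nil Z
  | cons x A ih =>
    have h1 := (ih fun s hs y hy => h s hs y (by simp [hy])).append_left [x]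
    have h2 := (Sorts.row fun s hs => h s hs x (by simp)).append_right A
    have h3 := h2.trans (by simpa using h1)
    simpa [ReducedWords.rows] using h3

/-! ### Counting crossings -/

/-- Each crossing moves its smaller entry one place to the right and its larger entry one place to
the left. -/
theorem Sorts.idxOf_add_countP {A S : List ℕ} {L : List (ℕ × ℕ)} (hA : A.Nodup) (h : Sorts A L S)
    (z : ℕ) : S.idxOf z + L.countP (fun l => l.2 == z) = A.idxOf z + L.countP fun l => l.1 == z := by
  induction h with
  | nil => simp
  | @cons P x y Q L B hxy h ih =>
    have hA' : (P ++ y :: x :: Q).Nodup :=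
      ((List.Perm.swap y x Q).append_left P).nodup_iff.1 hA
    have ih := ih hA'
    have hP : x ∉ P ∧ y ∉ P := by
      rw [List.nodup_append] at hA
      exact ⟨fun h => hA.2.2 x h x (by simp) rfl, fun h => hA.2.2 y h y (by simp) rfl⟩
    rw [List.countP_cons, List.countP_cons]
    rw [List.idxOf_append] at ih ⊢
    by_cases hz : z ∈ P
    · have h1 : x ≠ z := fun h => hP.1 (h ▸ hz)
      have h2 : y ≠ z := fun h => hP.2 (h ▸ hz)
      simp only [hz, if_true] at ih ⊢
      simp [h1, h2, ih]
    · simp only [hz, if_false, List.idxOf_cons, Bool.cond_eq_ite, beq_iff_eq] at ih ⊢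
      rcases eq_or_ne x z with rfl | h1
      · have h2 : y ≠ x := hxy.ne'
        simp [h2] at ih ⊢
        omega
      · rcases eq_or_ne y z with rfl | h2
        · simp [h1] at ih ⊢
          omega
        · simp [h1, h2] at ih ⊢
          omega

/-- A crossing whose larger strand is large never exchanges two small strands. -/
theorem Sorts.pairwise_small {b : ℕ} {A S : List ℕ} {L : List (ℕ × ℕ)} (h : Sorts A L S)
    (hL : ∀ l ∈ L, b ≤ l.2) (hA : A.Pairwise fun s t => s < b → t < b → s < t) :
    S.Pairwise fun s t => s < b → t < b → s < t := by
  induction h with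
  | nil => exact hA
  | @cons P x y Q L B hxy h ih =>
    have hy : b ≤ y := hL (x, y) (by simp)
    refine ih (fun l hl => hL l (by simp [hl])) ?_
    simp only [List.pairwise_append, List.pairwise_cons, List.mem_cons] at hA ⊢
    refine ⟨hA.1, ⟨?_, hA.2.1.1 |> fun h t ht => h t (.inr ht), hA.2.1.2.2⟩, ?_⟩
    · intro t _ h1; omega
    · rintro s hs t (rfl | rfl | ht)
      · exact hA.2.2 s hs t (by simp)
      · exact hA.2.2 s hs t (by simp)
      · exact hA.2.2 s hs t (by simp [ht])

theorem idxOf_range_append {b z : ℕ} (hz : z < b) (A : List ℕ) :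
    (List.range b ++ A).idxOf z = z := by
  rw [List.idxOf_append_of_mem (by simpa using hz)]
  have := (List.nodup_range (n := b)).idxOf_getElem z (by simpa using hz)
  simpa using this

/-- The small strand `z` stands at position `z` plus the number of its crossings. The small strands
keep their order, so their positions increase strictly and their numbers of crossings increase
weakly. -/
theorem Sorts.countP_mono {b : ℕ} {A S : List ℕ} {L : List (ℕ × ℕ)}
    (hA : (List.range b ++ A).Nodup) (h : Sorts (List.range b ++ A) L S)
    (hbA : ∀ x ∈ A, b ≤ x) (hL : ∀ l ∈ L, b ≤ l.2) {z z' : ℕ} (hzz : z ≤ z') (hz : z' < b) :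
    (L.countP fun l => l.1 == z) ≤ L.countP fun l => l.1 == z' := by
  have hidx : ∀ s < b, S.idxOf s = s + L.countP fun l => l.1 == s := by
    intro s hs
    have h1 := h.idxOf_add_countP hA s
    have h2 : (L.countP fun l => l.2 == s) = 0 := by
      rw [List.countP_eq_zero]
      intro l hl
      have := hL l hl
      simp; omega
    rwa [h2, idxOf_range_append hs, add_zero] at h1
  have hpw : S.Pairwise fun s t => s < b → t < b → s < t := by
    refine h.pairwise_small hL ?_
    rw [List.pairwise_append]
    refine ⟨List.pairwise_lt_range.imp fun h _ _ => h, ?_, ?_⟩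
    · refine List.Pairwise.imp_of_mem (R := fun _ _ => True) ?_ (List.pairwise_of_forall (by simp))
      intro s t hs _ _ hsb
      have := hbA s hs
      omega
    · intro s hs t ht _ htb
      have := hbA t ht
      omega
  induction z', hzz using Nat.le_induction with
  | base => rfl
  | succ z' hzz ih =>
    refine (ih (by omega)).trans ?_
    have h1 := hidx z' (by omega)
    have h2 := hidx (z' + 1) hz
    have hm : ∀ s < b, S.idxOf s < S.length := fun s hs =>
      List.idxOf_lt_length_iff.2 (h.perm.mem_iff.1 (by simp [hs]))
    by_contra hcon
    have h3 : S.idxOf (z' + 1) < S.idxOf z' ∨ S.idxOf (z' + 1) = S.idxOf z' := by omega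
    rcases h3 with h3 | h3
    · have := List.pairwise_iff_getElem.1 hpw _ _ (hm _ hz) (hm z' (by omega)) h3
      simp only [List.getElem_idxOf] at this
      have := this hz (by omega)
      omega
    · have h4 : z' + 1 ∈ S := h.perm.mem_iff.1 (by simp [hz])
      have := (List.idxOf_inj h4).1 h3
      omega

/-- The weight of a pair of crossings of small strands `l.1 < m.1 < b` with different strands. -/
def smallWeight (p b : ℕ) (l m : ℕ × ℕ) : ℕ :=
  if l.1 < m.1 ∧ m.1 < b ∧ l.2 ≠ m.2 then p else 0

/-- The condition that the second entries differ is dropped; every crossing of a smaller strand is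
charged p. -/
theorem sum_smallWeight_le (p b : ℕ) (L : List (ℕ × ℕ)) (m : ℕ × ℕ) :
    (L.map fun l => smallWeight p b l m).sum ≤
      if m.1 < b then p * ∑ z ∈ Finset.range m.1, L.countP (fun l => l.1 == z) else 0 := by
  induction L with
  | nil => simp
  | cons l L ih =>
    rw [List.map_cons, List.sum_cons]
    split_ifs with hm
    · rw [if_pos hm] at ih
      simp only [List.countP_cons, Finset.sum_add_distrib, mul_add]
      rw [add_comm]
      refine add_le_add ih ?_
      simp only [beq_iff_eq, Finset.sum_ite_eq, Finset.mem_range, smallWeight]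
      split_ifs <;> omega
    · rw [if_neg hm] at ih
      rw [smallWeight, if_neg (by omega), zero_add]
      exact ih

/-- When `z` makes its (k+1)-st crossing, each of the `z` smaller strands has made at most k
crossings. Summing over k gives a binomial coefficient for each smaller strand. -/
theorem Sorts.pairSum_smallWeight_le_sum (p : ℕ) {b : ℕ} {A S : List ℕ} {L : List (ℕ × ℕ)}
    (hA : (List.range b ++ A).Nodup) (h : Sorts (List.range b ++ A) L S)
    (hbA : ∀ x ∈ A, b ≤ x) (hL : ∀ l ∈ L, b ≤ l.2) :
    pairSum (smallWeight p b) L ≤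
      p * ∑ z ∈ Finset.range b, z * (L.countP fun l => l.1 == z).choose 2 := by
  induction L using List.reverseRecOn generalizing S with
  | nil => simp [pairSum]
  | append_singleton L m ih =>
    obtain ⟨C, h1, -⟩ := h.of_append
    have hL' : ∀ l ∈ L, b ≤ l.2 := fun l hl => hL l (by simp [hl])
    have ih := ih h1 hL'
    rw [pairSum_concat]
    have h2 := sum_smallWeight_le p b L m
    have hN : ∀ z, ((L ++ [m]).countP fun l => l.1 == z).choose 2 =
        (L.countP fun l => l.1 == z).choose 2 +
          if m.1 = z then L.countP (fun l => l.1 == z) else 0 := by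
      intro z
      rw [List.countP_append, List.countP_singleton]
      by_cases hz : m.1 = z
      · simp only [hz, beq_self_eq_true, if_true]
        rw [Nat.choose_succ_succ' _ 1, Nat.choose_one_right, add_comm]
      · simp [hz]
    simp only [hN, mul_add, Finset.sum_add_distrib, mul_ite, mul_zero, Finset.sum_ite_eq,
      Finset.mem_range]
    refine add_le_add ih (h2.trans ?_)
    split_ifs with hm
    · refine Nat.mul_le_mul_left p ?_
      calc _ ≤ ∑ z ∈ Finset.range m.1, L.countP (fun l => l.1 == m.1) := by
            refine Finset.sum_le_sum fun z hz => ?_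
            exact h1.countP_mono hA hbA hL' (Finset.mem_range.1 hz).le hm
        _ = _ := by simp
    · simp

/-- A small strand moves from position `z` to position `B.length + z`, so it has `B.length`
crossings, and the factors `z` sum to C(b,2). -/
theorem Sorts.pairSum_smallWeight_le (p : ℕ) {b : ℕ} {A B : List ℕ} {L : List (ℕ × ℕ)}
    (hA : (List.range b ++ A).Nodup) (h : Sorts (List.range b ++ A) L (B ++ List.range b))
    (hbA : ∀ x ∈ A, b ≤ x) (hL : ∀ l ∈ L, b ≤ l.2) :
    pairSum (smallWeight p b) L ≤ p * (B.length.choose 2 * b.choose 2) := by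
  refine (h.pairSum_smallWeight_le_sum p hA hbA hL).trans (Nat.mul_le_mul_left p ?_)
  have hB : (B ++ List.range b).Nodup := h.perm.nodup_iff.1 hA
  have hc : ∀ z ∈ Finset.range b, z * (L.countP fun l => l.1 == z).choose 2 ≤
      z * B.length.choose 2 := by
    intro z hz
    have hz := Finset.mem_range.1 hz
    have h1 := h.idxOf_add_countP hA z
    have h2 : (L.countP fun l => l.2 == z) = 0 := by
      rw [List.countP_eq_zero]
      intro l hl
      have := hL l hl
      simp; omega
    have hzB : z ∉ B := fun hzB =>
      (List.nodup_append.1 hB).2.2 z hzB z (by simpa using hz) rfl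
    have h3 := idxOf_range_append hz []
    rw [List.append_nil] at h3
    rw [idxOf_range_append hz, List.idxOf_append_of_notMem hzB, h3, h2] at h1
    exact Nat.mul_le_mul_left z (Nat.choose_le_choose 2 (by omega))
  refine (Finset.sum_le_sum hc).trans ?_
  rw [← Finset.sum_mul, Finset.sum_range_id, ← Nat.choose_two_right, mul_comm]

/-! ### The diameter estimates for label lists -/

/-- `D` is the largest weighted distance between label lists from `A` to `B`. -/
def LabelDiam (p q : ℕ) (A B : List ℕ) (D : ℕ) : Prop :=
  (∀ L M, Sorts A L B → Sorts A M B → ∃ c ≤ D, LabelReach p q L M c) ∧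
    ∃ L M, Sorts A L B ∧ Sorts A M B ∧ ∀ c, LabelReach p q L M c → D ≤ c

/-- The labels between strands that are at least `b`. -/
def largeLabels (b : ℕ) (L : List (ℕ × ℕ)) : List (ℕ × ℕ) :=
  L.filter fun l => decide (b ≤ l.1) && decide (b ≤ l.2)

theorem filter_large {b : ℕ} {A : List ℕ} (hbA : ∀ x ∈ A, b ≤ x) :
    (List.range b ++ A).filter (fun x => decide (b ≤ x)) = A ∧
      (A ++ List.range b).filter (fun x => decide (b ≤ x)) = A := by
  have h1 : (List.range b).filter (fun x => decide (b ≤ x)) = [] := by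
    simp [List.filter_eq_nil_iff]
  have h2 : A.filter (fun x => decide (b ≤ x)) = A := by
    simpa [List.filter_eq_self] using hbA
  simp [List.filter_append, h1, h2]

theorem Sorts.largeLabels {b : ℕ} {A B : List ℕ} {L : List (ℕ × ℕ)}
    (h : Sorts (List.range b ++ A) L (B ++ List.range b))
    (hbA : ∀ x ∈ A, b ≤ x) (hbB : ∀ x ∈ B, b ≤ x) : Sorts A (largeLabels b L) B := by
  have h1 := h.filter fun x => decide (b ≤ x)
  rwa [(filter_large hbA).1, (filter_large hbB).2] at h1

theorem filter_notMem_range {b : ℕ} (L : List (ℕ × ℕ)) {Z : List ℕ} (hZ : ∀ x, x ∈ Z ↔ x < b) :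
    (L.filter fun l => decide (l.1 ∉ Z) && decide (l.2 ∉ Z)) = largeLabels b L := by
  refine List.filter_congr fun l _ => ?_
  simp [hZ]

theorem sum_map_flatMap {S T : Type*} (l : List S) (f : S → List T) (g : T → ℕ) :
    ((l.flatMap f).map g).sum = (l.map fun s => ((f s).map g).sum).sum := by
  induction l with
  | nil => rfl
  | cons s l ih => simp [ih]

theorem sum_labelWeight (p q z : ℕ) {x y : ℕ} {B : List ℕ} (hB : B.Nodup) (hx : x ∈ B) (hy : y ∈ B)
    (hxy : x ≠ y) :
    (B.map fun x' => labelWeight p q (z, x') (x, y)).sum = (B.length - 2) * p + q := by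
  have h1 := List.perm_cons_erase hx
  have h2 := List.perm_cons_erase ((List.mem_erase_of_ne hxy.symm).2 hy)
  have h3 : B.Perm ([] ++ x :: y :: (B.erase x).erase y) := h1.trans (h2.cons x)
  rw [(h3.map _).sum_eq, sum_labelWeight_of_nodup p q z (h3.nodup_iff.1 hB), h3.length_eq]
  simp
  ring

theorem mem_columns {Z B : List ℕ} {l : ℕ × ℕ} : l ∈ columns Z B ↔ l.1 ∈ Z ∧ l.2 ∈ B := by
  obtain ⟨s, t⟩ := l
  simp [columns]

/-- The rank under which the small strands are reversed. -/
def reverseRank (b s : ℕ) : ℕ := if s < b then b - s else b + 1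

/-- The part of the weight that comes from pairs of a small and a large label. -/
def mixedWeight (p q b : ℕ) (l m : ℕ × ℕ) : ℕ :=
  (if l.1 < b ∧ b ≤ m.1 then labelWeight p q l m else 0) +
    if m.1 < b ∧ b ≤ l.1 then labelWeight p q m l else 0

/-- A small and a large label are in the wrong order for exactly one of the two normal forms. Two
small labels are in the wrong order for both or for neither, since in both forms the greater small
strand moves first. -/
theorem crossWeight_add_crossWeight (p q : ℕ) {b : ℕ} {l m : ℕ × ℕ} (hl : b ≤ l.2) (hm : b ≤ m.2) :
    crossWeight p q (List.range b) id l m +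
        crossWeight p q (List.range b).reverse (reverseRank b) m l =
      mixedWeight p q b l m + (smallWeight p b l m + smallWeight p b l m) := by
  simp only [crossWeight, mixedWeight, smallWeight, labelWeight, reverseRank, List.mem_range,
    List.mem_reverse, id]
  by_cases h1 : l.1 < b <;> by_cases h2 : m.1 < b
  · have h5 : l.2 ≠ m.1 := by omega
    have h6 : m.2 ≠ l.1 := by omega
    by_cases h3 : l.1 < m.1
    · have h4 : b - m.1 < b - l.1 := by omega
      by_cases h7 : l.2 = m.2
      · have h8 : m.2 ≠ m.1 := by omega
        simp [h1, h2, h3, h4, h6, h7, h8, h1.not_ge, h2.not_ge]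
      · simp [h1, h2, h3, h4, h5, h6, h7, Ne.symm h7, h1.not_ge, h2.not_ge]
    · have h4 : ¬ b - m.1 < b - l.1 := by omega
      simp [h1, h2, h3, h4, h1.not_ge, h2.not_ge]
  · have h3 : l.1 < m.1 := by omega
    simp [h1, h2, h3, not_lt.1 h2]
  · have h3 : b - m.1 < b + 1 := by omega
    have h4 : ¬ l.1 < m.1 := by omega
    simp [h1, h2, h3, h4, not_lt.1 h1]
  · simp [h1, h2]

theorem sum_columns_labelWeight (p q : ℕ) {b : ℕ} {B : List ℕ} (hB : B.Nodup) {l : ℕ × ℕ}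
    (h1 : l.1 ∈ B) (h2 : l.2 ∈ B) (h : l.1 ≠ l.2) :
    ((columns (List.range b) B).map fun m => labelWeight p q m l).sum =
      b * ((B.length - 2) * p + q) := by
  rw [columns, sum_map_flatMap]
  have : ∀ z, ((B.map (Prod.mk z)).map fun m => labelWeight p q m l).sum =
      (B.length - 2) * p + q := by
    intro z
    rw [List.map_map]
    exact sum_labelWeight p q z hB h1 h2 h
  simp only [this]
  simp

/-- Since `mixedWeight` is symmetric, its sum over any list with these labels can be evaluated on
this normal form, where each large label meets b complete columns. -/
theorem pairSum_mixedWeight (p q : ℕ) {b : ℕ} {A B : List ℕ} {u : List (ℕ × ℕ)} (hA : A.Nodup)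
    (hu : Sorts A u B) (hbA : ∀ x ∈ A, b ≤ x) :
    pairSum (mixedWeight p q b) (u ++ columns (List.range b) B) =
      u.length * (b * ((B.length - 2) * p + q)) := by
  have hu1 : ∀ l ∈ u, b ≤ l.1 := fun l hl => hbA _ (hu.lt_and_mem l hl).2.1
  have hc1 : ∀ l ∈ columns (List.range b) B, l.1 < b := fun l hl => by
    simpa using (mem_columns.1 hl).1
  have z1 : pairSum (mixedWeight p q b) u = 0 := by
    rw [pairSum_congr (g' := fun _ _ => 0)]
    · exact pairSum_eq_zero (List.pairwise_of_forall fun _ _ => rfl)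
    · intro l hl m hm
      simp [mixedWeight, (hu1 l hl).not_gt, (hu1 m hm).not_gt]
  have z2 : pairSum (mixedWeight p q b) (columns (List.range b) B) = 0 := by
    rw [pairSum_congr (g' := fun _ _ => 0)]
    · exact pairSum_eq_zero (List.pairwise_of_forall fun _ _ => rfl)
    · intro l hl m hm
      simp [mixedWeight, (hc1 l hl).not_ge, (hc1 m hm).not_ge]
  rw [pairSum_append, z1, z2, zero_add, zero_add]
  have : u.map (fun l => ((columns (List.range b) B).map (mixedWeight p q b l)).sum) =
      u.map fun _ => b * ((B.length - 2) * p + q) := by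
    refine List.map_congr_left fun l hl => ?_
    have h1 := hu.lt_and_mem l hl
    rw [← sum_columns_labelWeight p q (hu.perm.nodup_iff.1 hA) (hu.perm.mem_iff.1 h1.2.1)
      (hu.perm.mem_iff.1 h1.2.2) h1.1.ne]
    congr 1
    refine List.map_congr_left fun m hm => ?_
    simp [mixedWeight, (hu1 l hl).not_gt, hu1 l hl, hc1 m hm]
  rw [this]
  simp

theorem nodup_range_append {b : ℕ} {A : List ℕ} (hA : A.Nodup) (hbA : ∀ x ∈ A, b ≤ x) :
    (List.range b ++ A).Nodup := by
  refine List.nodup_append.2 ⟨List.nodup_range, hA, ?_⟩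
  rintro s hs t ht rfl
  have := hbA s ht
  have := List.mem_range.1 hs
  omega

/-- A label list can be moved to both normal forms, at a total cost that is bounded. -/
theorem Sorts.exists_reach_normal_forms (p q : ℕ) {b : ℕ} {A B : List ℕ} {L : List (ℕ × ℕ)}
    (hA : A.Nodup) (hbA : ∀ x ∈ A, b ≤ x)
    (h : Sorts (List.range b ++ A) L (B ++ List.range b)) (hbB : ∀ x ∈ B, b ≤ x) :
    ∃ c₁ c₂, LabelReach p q L (ReducedWords.largeLabels b L ++ ReducedWords.columns (List.range b) B) c₁ ∧
      LabelReach p q L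
        ((ReducedWords.columns (List.range b).reverse A.reverse).reverse ++ ReducedWords.largeLabels b L) c₂ ∧
      c₁ + c₂ ≤ (ReducedWords.largeLabels b L).length * (b * ((B.length - 2) * p + q)) +
        2 * (p * (B.length.choose 2 * b.choose 2)) := by
  have hnd := nodup_range_append hA hbA
  have h1 := (h.remove_prefix p q (r := id) hnd List.pairwise_lt_range
    fun z hz x hx => (List.mem_range.1 hz).trans_le (hbA x hx)).1
  -- The normal form with the large labels at the end is obtained by removing the small strands from
  -- the reversed diagram.
  have hrev := h.reverse
  rw [List.reverse_append, List.reverse_append] at hrev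
  have hnd' : ((List.range b).reverse ++ B.reverse).Nodup := by
    rw [← List.reverse_append, List.nodup_reverse]
    exact h.perm.nodup_iff.1 hnd
  have h2 := (hrev.remove_prefix p q (r := reverseRank b) hnd' (by
      rw [List.pairwise_reverse]
      refine List.Pairwise.imp_of_mem ?_ (List.pairwise_lt_range (n := b))
      intro s t hs ht hst
      simp only [List.mem_range] at hs ht
      simp only [reverseRank, hs, ht, if_true]
      omega) (by
      intro z hz x hx
      have h3 := hbB x (by simpa using hx)
      have h4 : z < b := by simpa using hz
      simp only [reverseRank, h4, if_true, h3.not_gt, if_false]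
      omega)).1
  rw [filter_notMem_range (b := b) _ (by simp)] at h1 h2
  have h2 := LabelReach.reverse h2
  rw [List.reverse_reverse, List.reverse_append,
    show ReducedWords.largeLabels b L.reverse = (ReducedWords.largeLabels b L).reverse from
      List.filter_reverse .., List.reverse_reverse, pairSum_reverse] at h2
  refine ⟨_, _, h1, h2, ?_⟩
  have hu := h.largeLabels hbA hbB
  have hL : ∀ l ∈ L, b ≤ l.2 := by
    intro l hl
    rcases List.mem_append.1 (h1.perm.mem_iff.1 hl) with h3 | h3
    · exact hbA _ (hu.lt_and_mem l h3).2.2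
    · exact hbB _ (mem_columns.1 h3).2
  -- After `pairSum_reverse` both costs are sums over the same ordered pairs of `L`, so they can be
  -- added pair by pair.
  rw [← pairSum_add, pairSum_congr fun l hl m hm =>
    crossWeight_add_crossWeight p q (hL l hl) (hL m hm), pairSum_add, pairSum_add,
    pairSum_perm (fun l m => by simp only [mixedWeight]; ring) h1.perm,
    pairSum_mixedWeight p q hA hu hbA]
  have := h.pairSum_smallWeight_le p hnd hbA hL
  omega

/-- For a pair at maximal distance, the routes through the two normal forms cost at most c₁ + D + d₁
and c₂ + D + d₂. Only the sums c₁ + c₂ and d₁ + d₂ are controlled, and averaging the two routes is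
enough. -/
theorem LabelDiam.upper {p q b k D D' : ℕ} {A B : List ℕ} (hA : A.Nodup) (hbA : ∀ x ∈ A, b ≤ x)
    (hk : ∀ u, Sorts A u B → u.length = k) (hD : LabelDiam p q A B D)
    (hD' : LabelDiam p q (List.range b ++ A) (B ++ List.range b) D') :
    D' ≤ D + k * (b * ((B.length - 2) * p + q)) + 2 * (p * (B.length.choose 2 * b.choose 2)) := by
  obtain ⟨L, M, hL, hM, hmin⟩ := hD'.2
  have hbB : ∀ x ∈ B, b ≤ x := by
    obtain ⟨u, _, hu, -⟩ := hD.2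
    exact fun x hx => hbA x (hu.perm.mem_iff.2 hx)
  have hLu := hL.largeLabels hbA hbB
  have hMu := hM.largeLabels hbA hbB
  obtain ⟨c, hc, hR⟩ := hD.1 _ _ hLu hMu
  obtain ⟨c₁, c₂, h1, h2, h3⟩ := hL.exists_reach_normal_forms p q hA hbA hbB
  obtain ⟨d₁, d₂, h4, h5, h6⟩ := hM.exists_reach_normal_forms p q hA hbA hbB
  rw [hk _ hLu] at h3
  rw [hk _ hMu] at h6
  have h7 := hmin _ ((h1.trans (hR.append_right _)).trans h4.symm)
  have h8 := hmin _ ((h2.trans (hR.append_left _)).trans h5.symm)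
  omega

/-! ### The lower bound -/

/-- Rearranging a block affects only the pairs inside the block. -/
theorem pairSum_block {T : Type*} (g : T → T → ℕ) (X Y : List T) {I J : List T} (h : I.Perm J) :
    pairSum g (X ++ J ++ Y) + pairSum g I = pairSum g (X ++ I ++ Y) + pairSum g J := by
  have h1 : ∀ x, (I.map (g x)).sum = (J.map (g x)).sum := fun x => (h.map (g x)).sum_eq
  have h2 : ∀ f : T → ℕ, (I.map f).sum = (J.map f).sum := fun f => (h.map f).sum_eq
  simp only [pairSum_append, List.map_append, List.sum_append, h1, h2]
  ring

/-- Along a path, the weight of a label list changes at most by the cost of the moves that do not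
act on the large labels. -/
theorem LabelReach.exists_large {p q b c : ℕ} {L M : List (ℕ × ℕ)} (h : LabelReach p q L M c) :
    ∃ d, LabelReach p q (largeLabels b L) (largeLabels b M) d ∧
      pairSum (crossWeight p q (List.range b) id) M + d ≤
        pairSum (crossWeight p q (List.range b) id) L + c := by
  induction h with
  | refl => exact ⟨0, .refl _, le_rfl⟩
  | @fst L N M c h _ ih =>
    obtain ⟨d, hd, hle⟩ := ih
    obtain ⟨X, Y, l, m, hne, rfl, rfl⟩ := h
    have hb := pairSum_block (crossWeight p q (List.range b) id) X Y (List.Perm.swap m l [])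
    have hp : ∀ l m : ℕ × ℕ, pairSum (crossWeight p q (List.range b) id) [l, m] =
        crossWeight p q (List.range b) id l m := by simp [pairSum]
    rw [hp, hp] at hb
    -- If both labels are large, the move survives in the projection and leaves the potential
    -- unchanged. Otherwise the projection is unchanged and the potential drops by at most p.
    by_cases hlm : (b ≤ l.1 ∧ b ≤ l.2) ∧ (b ≤ m.1 ∧ b ≤ m.2)
    · refine ⟨p + d, .fst ⟨largeLabels b X, largeLabels b Y, l, m, hne, ?_, ?_⟩ hd, ?_⟩
      · simp [largeLabels, hlm]
      · simp [largeLabels, hlm]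
      · have h1 : crossWeight p q (List.range b) id l m = 0 := by
          simp [crossWeight, hlm.1.1.not_gt]
        have h2 : crossWeight p q (List.range b) id m l = 0 := by
          simp [crossWeight, hlm.2.1.not_gt]
        omega
    · refine ⟨d, ?_, ?_⟩
      · convert hd using 1
        simp only [largeLabels, List.filter_append]
        congr 2
        by_cases h1 : b ≤ l.1 ∧ b ≤ l.2
        · have h2 : ¬ (b ≤ m.1 ∧ b ≤ m.2) := fun h2 => hlm ⟨h1, h2⟩
          simp [h1, h2]
        · simp [List.filter_cons, h1]
      · have h2 : crossWeight p q (List.range b) id m l ≤ p := by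
          simp only [crossWeight, labelWeight]
          split_ifs <;> omega
        omega
  | @snd L N M c h _ ih =>
    obtain ⟨d, hd, hle⟩ := ih
    obtain ⟨X, Y, x, y, z, hxy, hyz, h⟩ := h
    have hb := pairSum_block (crossWeight p q (List.range b) id) X Y
      (List.reverse_perm [(y, z), (x, z), (x, y)])
    have e1 : pairSum (crossWeight p q (List.range b) id) [(x, y), (x, z), (y, z)] =
        if x < b then q else 0 := by
      simp [pairSum, crossWeight, labelWeight, hxy, hyz.ne']
    have e2 : pairSum (crossWeight p q (List.range b) id) [(y, z), (x, z), (x, y)] = 0 := by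
      simp [pairSum, crossWeight, hxy.le]
    simp only [List.reverse_cons, List.reverse_nil, List.nil_append, List.cons_append] at hb
    rw [e1, e2] at hb
    -- If x is small, the block contains at most one large label, so the projection is unchanged and
    -- the potential changes by exactly q. If x is large, the whole triple is large and the braid
    -- move survives in the projection.
    by_cases hx : x < b
    · have hf : largeLabels b (X ++ [(x, y), (x, z), (y, z)] ++ Y) =
          largeLabels b (X ++ [(y, z), (x, z), (x, y)] ++ Y) := by
        simp [largeLabels, List.filter_append, List.filter_cons, hx.not_ge]
      rw [if_pos hx] at hb
      rcases h with ⟨rfl, rfl⟩ | ⟨rfl, rfl⟩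
      · exact ⟨d, by rwa [hf], by omega⟩
      · exact ⟨d, by rwa [← hf], by omega⟩
    · rw [if_neg hx] at hb
      have h1 : b ≤ x := not_lt.1 hx
      have h2 : b ≤ y := by omega
      have h3 : b ≤ z := by omega
      have h4 : LabelBraid (largeLabels b L) (largeLabels b N) := by
        refine ⟨largeLabels b X, largeLabels b Y, x, y, z, hxy, hyz, ?_⟩
        rcases h with ⟨rfl, rfl⟩ | ⟨rfl, rfl⟩
        · left; simp [largeLabels, h1, h2, h3]
        · right; simp [largeLabels, h1, h2, h3]
      refine ⟨q + d, .snd h4 hd, ?_⟩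
      rcases h with ⟨rfl, rfl⟩ | ⟨rfl, rfl⟩ <;> omega

theorem largeLabels_eq_self {b : ℕ} {A B : List ℕ} {u : List (ℕ × ℕ)} (hu : Sorts A u B)
    (hbA : ∀ x ∈ A, b ≤ x) : largeLabels b u = u := by
  rw [largeLabels, List.filter_eq_self]
  intro l hl
  have := hu.lt_and_mem l hl
  simp [hbA _ this.2.1, hbA _ this.2.2]

theorem largeLabels_eq_nil {b : ℕ} {L : List (ℕ × ℕ)} (h : ∀ l ∈ L, l.1 < b) :
    largeLabels b L = [] := by
  rw [largeLabels, List.filter_eq_nil_iff]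
  intro l hl
  simp [(h l hl).not_ge]

theorem mem_rows {Z A : List ℕ} {l : ℕ × ℕ} : l ∈ rows Z A ↔ l.1 ∈ Z ∧ l.2 ∈ A := by
  obtain ⟨s, t⟩ := l
  simp [rows, and_comm]

theorem rows_perm_columns (Z A : List ℕ) : (rows Z A).Perm (columns Z A) := by
  induction A with
  | nil => simp [rows, columns]
  | cons x A ih =>
    have h1 : (columns Z (x :: A)).Perm (Z.reverse.map (fun z => (z, x)) ++ columns Z A) := by
      simp only [columns]
      induction Z.reverse with
      | nil => simp
      | cons z Z ihZ =>
        simp only [List.flatMap_cons, List.map_cons, List.cons_append]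
        refine List.Perm.cons _ ?_
        refine (ihZ.append_left _).trans ?_
        rw [← List.append_assoc, ← List.append_assoc]
        exact List.perm_append_comm.append_right _
    refine List.Perm.trans ?_ h1.symm
    simpa [rows] using ih.append_left _

/-- No pair is in the wrong order: the large labels come first, followed by the small strands from
the greatest to the least. -/
theorem pairSum_crossWeight_columns (p q : ℕ) {b : ℕ} {A B : List ℕ} {u : List (ℕ × ℕ)}
    (hu : Sorts A u B) (hbA : ∀ x ∈ A, b ≤ x) :
    pairSum (crossWeight p q (List.range b) id) (u ++ columns (List.range b) B) = 0 := by
  have hu1 : ∀ l ∈ u, b ≤ l.1 := fun l hl => hbA _ (hu.lt_and_mem l hl).2.1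
  refine pairSum_eq_zero (List.pairwise_append.2 ⟨?_, ?_, ?_⟩)
  · refine List.Pairwise.imp_of_mem (R := fun _ _ => True) ?_ (List.pairwise_of_forall (by simp))
    intro l m hl _ _
    simp [crossWeight, (hu1 l hl).not_gt]
  · rw [columns, List.pairwise_flatMap]
    constructor
    · intro z _
      rw [List.pairwise_map]
      exact List.pairwise_of_forall fun x y => by simp [crossWeight]
    · rw [List.pairwise_reverse]
      refine List.pairwise_lt_range.imp fun {s t} hst l hl m hm => ?_
      obtain ⟨_, -, rfl⟩ := List.mem_map.1 hl
      obtain ⟨_, -, rfl⟩ := List.mem_map.1 hm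
      simp [crossWeight, hst.le]
  · intro l hl m _
    simp [crossWeight, (hu1 l hl).not_gt]

theorem sum_range_if_lt (b z p : ℕ) :
    ((List.range b).map fun z' => if z < z' then p else 0).sum = (b - 1 - z) * p := by
  induction b with
  | zero => simp
  | succ b ih =>
    rw [List.range_succ, List.map_append, List.sum_append, ih]
    simp only [List.map_cons, List.map_nil, List.sum_cons, List.sum_nil, add_zero]
    split_ifs with h
    · rw [← Nat.succ_mul]; congr 1; omega
    · rw [show b - 1 - z = 0 by omega, show b + 1 - 1 - z = 0 by omega]; simp

theorem sum_range_sum_if_lt (b p : ℕ) :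
    ((List.range b).map fun z =>
      ((List.range b).map fun z' => if z < z' then p else 0).sum).sum = b.choose 2 * p := by
  simp only [sum_range_if_lt, List.sum_map_mul_right]
  congr 1
  have : ((List.range b).map fun z => b - 1 - z).sum = ∑ z ∈ Finset.range b, (b - 1 - z) := rfl
  rw [this, Finset.sum_range_reflect (fun z => z) b, Finset.sum_range_id, Nat.choose_two_right]

/-- For x before y in `A` and z < z' < b, the label (z, x) precedes (z', y), and this pair costs p.
-/
theorem pairSum_crossWeight_rows (p q : ℕ) {b : ℕ} {A : List ℕ} (hA : A.Nodup)
    (hbA : ∀ x ∈ A, b ≤ x) :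
    p * (A.length.choose 2 * b.choose 2) ≤
      pairSum (crossWeight p q (List.range b) id) (rows (List.range b) A) := by
  induction A with
  | nil => simp
  | cons x A ih =>
    have ih := ih (List.nodup_cons.1 hA).2 fun y hy => hbA y (by simp [hy])
    have h1 : rows (List.range b) (x :: A) =
        (List.range b).reverse.map (fun z => (z, x)) ++ rows (List.range b) A := by simp [rows]
    have hsum : ∀ y ∈ A, (((List.range b).reverse.map fun z => (z, x)).map fun l =>
        (((List.range b).reverse.map fun z => (z, y)).map
          (crossWeight p q (List.range b) id l)).sum).sum = b.choose 2 * p := by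
      intro y hy
      have hxy : x ≠ y := fun h => (List.nodup_cons.1 hA).1 (h ▸ hy)
      rw [← sum_range_sum_if_lt]
      simp only [List.map_map, List.map_reverse, List.sum_reverse]
      congr 1
      refine List.map_congr_left fun z hz => ?_
      simp only [Function.comp_apply]
      congr 1
      refine List.map_congr_left fun z' hz' => ?_
      have hx := hbA x (by simp)
      have h2 : x ≠ z' := by have := List.mem_range.1 hz'; omega
      have h3 := List.mem_range.1 hz
      simp [crossWeight, labelWeight, h2, hxy, h3]
    have hcross : (((List.range b).reverse.map fun z => (z, x)).map fun l =>
        ((rows (List.range b) A).map (crossWeight p q (List.range b) id l)).sum).sum =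
        A.length * (b.choose 2 * p) := by
      clear ih h1
      have : ∀ A' : List ℕ, (∀ y ∈ A', y ∈ A) →
          (((List.range b).reverse.map fun z => (z, x)).map fun l =>
          ((rows (List.range b) A').map (crossWeight p q (List.range b) id l)).sum).sum =
          A'.length * (b.choose 2 * p) := by
        intro A' hA'
        induction A' with
        | nil => simp [rows, Function.comp_def]
        | cons y A' ih =>
          have h1 : rows (List.range b) (y :: A') =
            (List.range b).reverse.map (fun z => (z, y)) ++ rows (List.range b) A' := by simp [rows]
          rw [List.length_cons, add_mul, one_mul, ← ih fun y hy => hA' y (by simp [hy]),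
            ← hsum y (hA' y (by simp)), h1]
          simp only [List.map_append, List.sum_append, List.sum_map_add]
          rw [add_comm]
      exact this A fun _ h => h
    rw [h1, pairSum_append, hcross, List.length_cons, Nat.choose_succ_succ' _ 1,
      Nat.choose_one_right]
    nlinarith

theorem pairSum_crossWeight_rows_append (p q : ℕ) {b : ℕ} {A B : List ℕ} {v : List (ℕ × ℕ)}
    (hA : A.Nodup) (hv : Sorts A v B) (hbA : ∀ x ∈ A, b ≤ x) :
    v.length * (b * ((A.length - 2) * p + q)) + p * (A.length.choose 2 * b.choose 2) ≤
      pairSum (crossWeight p q (List.range b) id) (rows (List.range b) A ++ v) := by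
  rw [pairSum_append]
  have h1 := pairSum_crossWeight_rows p q hA hbA
  have h2 : ((rows (List.range b) A).map fun l =>
      (v.map (crossWeight p q (List.range b) id l)).sum).sum =
      v.length * (b * ((A.length - 2) * p + q)) := by
    -- All labels of the rows precede `v`, so only their multiset matters and they may be regrouped
    -- into columns.
    rw [((rows_perm_columns _ _).map _).sum_eq]
    have hcomm : ∀ (X Y : List (ℕ × ℕ)) (g : ℕ × ℕ → ℕ × ℕ → ℕ),
        (X.map fun l => (Y.map (g l)).sum).sum = (Y.map fun m => (X.map fun l => g l m).sum).sum := by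
      intro X Y g
      induction X with
      | nil => simp
      | cons l X ih => simp [ih, List.sum_map_add]
    rw [hcomm]
    have : v.map (fun m => ((columns (List.range b) A).map fun l =>
        crossWeight p q (List.range b) id l m).sum) =
        v.map fun _ => b * ((A.length - 2) * p + q) := by
      refine List.map_congr_left fun m hm => ?_
      have h1 := hv.lt_and_mem m hm
      rw [← sum_columns_labelWeight p q hA h1.2.1 h1.2.2 h1.1.ne]
      congr 1
      refine List.map_congr_left fun l hl => ?_
      have h2 : l.1 < b := by simpa using (mem_columns.1 hl).1
      have h3 : l.1 < m.1 := h2.trans_le (hbA _ h1.2.1)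
      simp [crossWeight, h2, h3]
    rw [this]
    simp
  omega

/-- Let u, v be at maximal distance for α. The list u followed by columns has potential zero, and
rows followed by v has the large potential of `pairSum_crossWeight_rows_append`. A path between them
pays for this difference and also projects to a path from u to v. -/
theorem LabelDiam.lower {p q b k D D' : ℕ} {A B : List ℕ} (hA : A.Nodup) (hbA : ∀ x ∈ A, b ≤ x)
    (hk : ∀ u, Sorts A u B → u.length = k) (hD : LabelDiam p q A B D)
    (hD' : LabelDiam p q (List.range b ++ A) (B ++ List.range b) D') :
    D + k * (b * ((A.length - 2) * p + q)) + p * (A.length.choose 2 * b.choose 2) ≤ D' := by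
  obtain ⟨u, v, hu, hv, hmin⟩ := hD.2
  have hbB : ∀ x ∈ B, b ≤ x := fun x hx => hbA x (hu.perm.mem_iff.2 hx)
  have h1 := (hu.append_left (List.range b)).trans
    (Sorts.columns fun z hz x hx => (List.mem_range.1 hz).trans_le (hbB x hx))
  have h2 := (Sorts.rows fun z hz x hx => (List.mem_range.1 hz).trans_le (hbA x hx)).trans
    (hv.append_right (List.range b))
  obtain ⟨c, hc, hR⟩ := hD'.1 _ _ h1 h2
  obtain ⟨d, hd, hle⟩ := LabelReach.exists_large (b := b) hR
  rw [pairSum_crossWeight_columns p q hu hbA] at hle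
  have h3 : largeLabels b (u ++ columns (List.range b) B) = u := by
    have := largeLabels_eq_nil (b := b) (L := columns (List.range b) B) fun l hl => by
      simpa using (mem_columns.1 hl).1
    rw [largeLabels] at this
    rw [largeLabels, List.filter_append, this, List.append_nil]
    exact largeLabels_eq_self hu hbA
  have h4 : largeLabels b (rows (List.range b) A ++ v) = v := by
    have := largeLabels_eq_nil (b := b) (L := rows (List.range b) A) fun l hl => by
      simpa using (mem_rows.1 hl).1
    rw [largeLabels] at this
    rw [largeLabels, List.filter_append, this, List.nil_append]
    exact largeLabels_eq_self hv hbA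
  rw [h3, h4] at hd
  have h5 := hmin d hd
  have h6 := pairSum_crossWeight_rows_append p q hA hv hbA
  rw [hk v hv] at h6
  omega

/-! ### Words and label lists -/

/-- `WordSorts A w L B`: the word `w` transforms the list `A` into `B`, each letter `i`
interchanging the entries `x < y` on the positions `i` and `i + 1`, and `L` is the list of the
pairs `(x, y)`. -/
inductive WordSorts : List ℕ → List ℕ → List (ℕ × ℕ) → List ℕ → Prop
  | nil (A : List ℕ) : WordSorts A [] [] A
  | cons {P : List ℕ} {x y : ℕ} {Q : List ℕ} {w : List ℕ} {L : List (ℕ × ℕ)} {B : List ℕ} : x < y →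
      WordSorts (P ++ y :: x :: Q) w L B →
      WordSorts (P ++ x :: y :: Q) (P.length :: w) ((x, y) :: L) B

namespace WordSorts

variable {A B B' C : List ℕ} {w w' : List ℕ} {L M : List (ℕ × ℕ)}

theorem sorts (h : WordSorts A w L B) : Sorts A L B := by
  induction h with
  | nil => exact .nil _
  | cons hxy _ ih => exact .cons hxy ih

theorem of_sorts (h : Sorts A L B) : ∃ w, WordSorts A w L B := by
  induction h with
  | nil A => exact ⟨[], .nil _⟩
  | cons hxy _ ih =>
    obtain ⟨w, hw⟩ := ih
    exact ⟨_, .cons hxy hw⟩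

theorem length_eq (h : WordSorts A w L B) : w.length = L.length := by
  induction h with
  | nil => rfl
  | cons _ _ ih => simp [ih]

theorem lt_length (h : WordSorts A w L B) : ∀ i ∈ w, i + 1 < A.length := by
  induction h with
  | nil => simp
  | cons _ _ ih =>
    intro i hi
    rcases List.mem_cons.1 hi with rfl | hi
    · simp
    · simpa using ih i hi

theorem trans (h : WordSorts A w L B) (h' : WordSorts B w' M C) :
    WordSorts A (w ++ w') (L ++ M) C := by
  induction h with
  | nil => exact h'
  | cons hxy _ ih => exact .cons hxy (ih h')

theorem of_append_word (h : WordSorts A (w ++ w') L B) :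
    ∃ L₁ L₂ C, L = L₁ ++ L₂ ∧ WordSorts A w L₁ C ∧ WordSorts C w' L₂ B := by
  induction w generalizing A L with
  | nil => exact ⟨[], L, A, rfl, .nil A, h⟩
  | cons i w ih =>
    cases h with
    | cons hxy h =>
      obtain ⟨L₁, L₂, C, rfl, h1, h2⟩ := ih h
      exact ⟨_, L₂, C, rfl, .cons hxy h1, h2⟩

theorem of_append_label (h : WordSorts A w (L ++ M) B) :
    ∃ w₁ w₂ C, w = w₁ ++ w₂ ∧ WordSorts A w₁ L C ∧ WordSorts C w₂ M B := by
  induction L generalizing A w with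
  | nil => exact ⟨[], w, A, rfl, .nil A, h⟩
  | cons i L ih =>
    cases h with
    | cons hxy h =>
      obtain ⟨w₁, w₂, C, rfl, h1, h2⟩ := ih h
      exact ⟨_, w₂, C, rfl, .cons hxy h1, h2⟩

theorem of_cons {i : ℕ} (h : WordSorts A (i :: w) L B) : ∃ P x y Q M, x < y ∧ P.length = i ∧
    A = P ++ x :: y :: Q ∧ L = (x, y) :: M ∧ WordSorts (P ++ y :: x :: Q) w M B := by
  cases h with
  | cons hxy h => exact ⟨_, _, _, _, _, hxy, rfl, rfl, rfl, h⟩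

theorem of_cons_label {x y : ℕ} (h : WordSorts A w ((x, y) :: L) B) : ∃ P Q w', x < y ∧
    A = P ++ x :: y :: Q ∧ w = P.length :: w' ∧ WordSorts (P ++ y :: x :: Q) w' L B := by
  cases h with
  | cons hxy h => exact ⟨_, _, _, hxy, rfl, rfl, h⟩

theorem of_nil (h : WordSorts A [] L B) : L = [] ∧ A = B := by
  cases h; exact ⟨rfl, rfl⟩

theorem of_nil_label (h : WordSorts A w [] B) : w = [] ∧ A = B := by
  cases h; exact ⟨rfl, rfl⟩

theorem label_unique (h : WordSorts A w L B) (h' : WordSorts A w M B') : L = M ∧ B = B' := by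
  induction w generalizing A L M with
  | nil =>
    obtain ⟨rfl, rfl⟩ := h.of_nil
    obtain ⟨rfl, rfl⟩ := h'.of_nil
    exact ⟨rfl, rfl⟩
  | cons i w ih =>
    obtain ⟨P, x, y, Q, L₁, -, hP, rfl, rfl, h1⟩ := h.of_cons
    obtain ⟨P', x', y', Q', L₁', -, hP', he, rfl, h1'⟩ := h'.of_cons
    obtain ⟨rfl, h2⟩ := List.append_inj he (hP.trans hP'.symm)
    simp only [List.cons.injEq] at h2
    obtain ⟨rfl, rfl, rfl⟩ := h2
    obtain ⟨rfl, rfl⟩ := ih h1 h1'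
    exact ⟨rfl, rfl⟩

/-- As entries do not repeat, a label determines the position of its crossing. With `label_unique`,
words and label lists determine each other. -/
theorem word_unique (hA : A.Nodup) (h : WordSorts A w L B) (h' : WordSorts A w' L B') :
    w = w' := by
  induction L generalizing A w w' with
  | nil => rw [h.of_nil_label.1, h'.of_nil_label.1]
  | cons l L ih =>
    obtain ⟨x, y⟩ := l
    obtain ⟨P, Q, w₁, hxy, rfl, rfl, h1⟩ := h.of_cons_label
    obtain ⟨P', Q', w₁', -, he, rfl, h1'⟩ := h'.of_cons_label
    obtain ⟨rfl, h2⟩ := append_cons_inj_of_nodup hA he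
    simp only [List.cons.injEq, true_and] at h2
    subst h2
    rw [ih ((Sorts.single P hxy Q).perm.nodup_iff.1 hA) h1 h1']

/-- Two crossings at distance at least two can be made in either order. -/
theorem comm_pair {P Q R : List ℕ} {x y x' y' : ℕ} (hxy : x < y) (hxy' : x' < y') :
    WordSorts (P ++ x :: y :: (Q ++ x' :: y' :: R)) [P.length, P.length + 2 + Q.length]
        [(x, y), (x', y')] (P ++ y :: x :: (Q ++ y' :: x' :: R)) ∧
      WordSorts (P ++ x :: y :: (Q ++ x' :: y' :: R)) [P.length + 2 + Q.length, P.length]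
        [(x', y'), (x, y)] (P ++ y :: x :: (Q ++ y' :: x' :: R)) := by
  have e : ∀ s t, P.length + 2 + Q.length = (P ++ s :: t :: Q).length := by
    intro s t; simp; omega
  constructor
  · refine .cons hxy ?_
    rw [e y x]
    have := WordSorts.cons (P := P ++ y :: x :: Q) (Q := R) hxy' (.nil _)
    simpa using this
  · rw [e x y]
    have := WordSorts.cons (P := P ++ x :: y :: Q) (Q := R) hxy'
      (by simpa using WordSorts.cons (P := P) (Q := Q ++ y' :: x' :: R) hxy (.nil _))
    simpa using this

/-- Both ways to reverse three adjacent entries. -/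
theorem braid_triple {P Q : List ℕ} {x y z : ℕ} (hxy : x < y) (hyz : y < z) :
    WordSorts (P ++ x :: y :: z :: Q) [P.length, P.length + 1, P.length]
        [(x, y), (x, z), (y, z)] (P ++ z :: y :: x :: Q) ∧
      WordSorts (P ++ x :: y :: z :: Q) [P.length + 1, P.length, P.length + 1]
        [(y, z), (x, z), (x, y)] (P ++ z :: y :: x :: Q) := by
  have e : ∀ s, P.length + 1 = (P ++ [s]).length := by simp
  have hxz := hxy.trans hyz
  constructor
  · refine .cons hxy ?_
    rw [e y]
    have := WordSorts.cons (P := P ++ [y]) (Q := Q) hxz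
      (by simpa using WordSorts.cons (P := P) (Q := x :: Q) hyz (.nil _))
    simpa using this
  · have h1 := WordSorts.cons (P := P ++ [z]) (Q := Q) hxy (.nil _)
    have h2 := WordSorts.cons (P := P) (Q := y :: Q) hxz (by simpa using h1)
    have h3 := WordSorts.cons (P := P ++ [x]) (Q := Q) hyz (by simpa using h2)
    simpa using h3

theorem of_pair {i j : ℕ} (h : WordSorts A [i, j] L B) : ∃ P x y Q P' x' y' Q',
    x < y ∧ x' < y' ∧ P.length = i ∧ P'.length = j ∧ A = P ++ x :: y :: Q ∧
    P ++ y :: x :: Q = P' ++ x' :: y' :: Q' ∧ B = P' ++ y' :: x' :: Q' ∧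
    L = [(x, y), (x', y')] := by
  obtain ⟨P, x, y, Q, M, hxy, hP, rfl, rfl, h1⟩ := h.of_cons
  obtain ⟨P', x', y', Q', M', hxy', hP', he, rfl, h2⟩ := h1.of_cons
  obtain ⟨rfl, rfl⟩ := h2.of_nil
  exact ⟨P, x, y, Q, P', x', y', Q', hxy, hxy', hP, hP', rfl, he, rfl, rfl⟩

/-- The layout of `A` is returned so that the disjointness of the two labels can later be read off
from the absence of repetitions. -/
theorem comm_of_word {j k : ℕ} (hjk : j + 1 < k ∨ k + 1 < j) (h : WordSorts A [j, k] L B) :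
    ∃ l m : ℕ × ℕ, L = [l, m] ∧ WordSorts A [k, j] [m, l] B ∧
      ∃ P Q R, A = P ++ l.1 :: l.2 :: (Q ++ m.1 :: m.2 :: R) ∨
        A = P ++ m.1 :: m.2 :: (Q ++ l.1 :: l.2 :: R) := by
  obtain ⟨P, x, y, Q, P', x', y', Q', hxy, hxy', rfl, rfl, rfl, he, rfl, rfl⟩ := h.of_pair
  refine ⟨(x, y), (x', y'), rfl, ?_⟩
  rcases List.append_eq_append_iff.1 he with ⟨D, rfl, h4⟩ | ⟨D, rfl, h4⟩
  · rcases D with _ | ⟨d, _ | ⟨e, D⟩⟩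
    · simp at hjk
    · simp at hjk; omega
    · simp only [List.cons_append, List.cons.injEq] at h4
      obtain ⟨rfl, rfl, rfl⟩ := h4
      refine ⟨?_, P, D, Q', .inl rfl⟩
      have := (comm_pair (P := P) (Q := D) (R := Q') hxy hxy').2
      convert this using 1
      · simp; omega
      · simp
  · rcases D with _ | ⟨d, _ | ⟨e, D⟩⟩
    · simp at hjk
    · simp at hjk; omega
    · simp only [List.cons_append, List.cons.injEq] at h4
      obtain ⟨rfl, rfl, rfl⟩ := h4
      refine ⟨?_, P', D, Q, .inr (by simp)⟩
      have := (comm_pair (P := P') (Q := D) (R := Q) hxy' hxy).1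
      convert this using 1
      · simp
      · simp; omega

/-- Crossings at equal or neighbouring positions would have a strand in common. -/
theorem comm_of_label {l m : ℕ × ℕ} (hne : l.1 ≠ m.1 ∧ l.1 ≠ m.2 ∧ l.2 ≠ m.1 ∧ l.2 ≠ m.2)
    (h : WordSorts A w [l, m] B) :
    ∃ j k : ℕ, (j + 1 < k ∨ k + 1 < j) ∧ w = [j, k] ∧ WordSorts A [k, j] [m, l] B := by
  obtain ⟨x, y⟩ := l
  obtain ⟨x', y'⟩ := m
  obtain ⟨P, Q, w₁, hxy, rfl, rfl, h1⟩ := h.of_cons_label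
  obtain ⟨P', Q', w₂, hxy', he, rfl, h2⟩ := h1.of_cons_label
  obtain ⟨rfl, rfl⟩ := h2.of_nil_label
  dsimp only at hne
  refine ⟨P.length, P'.length, ?_, rfl, ?_⟩
  · rcases List.append_eq_append_iff.1 he with ⟨D, rfl, h4⟩ | ⟨D, rfl, h4⟩
    · rcases D with _ | ⟨d, _ | ⟨e, D⟩⟩
      · simp at h4; omega
      · simp at h4; omega
      · left; simp
    · rcases D with _ | ⟨d, _ | ⟨e, D⟩⟩
      · simp at h4; omega
      · simp at h4; omega
      · right; simp
  · rcases List.append_eq_append_iff.1 he with ⟨D, rfl, h4⟩ | ⟨D, rfl, h4⟩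
    · rcases D with _ | ⟨d, _ | ⟨e, D⟩⟩
      · simp at h4; omega
      · simp at h4; omega
      · simp only [List.cons_append, List.cons.injEq] at h4
        obtain ⟨rfl, rfl, rfl⟩ := h4
        have := (comm_pair (P := P) (Q := D) (R := Q') hxy hxy').2
        convert this using 1
        · simp; omega
        · simp
    · rcases D with _ | ⟨d, _ | ⟨e, D⟩⟩
      · simp at h4; omega
      · simp at h4; omega
      · simp only [List.cons_append, List.cons.injEq] at h4
        obtain ⟨rfl, rfl, rfl⟩ := h4
        have := (comm_pair (P := P') (Q := D) (R := Q) hxy' hxy).1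
        convert this using 1
        · simp
        · simp; omega

theorem braid_of_word {j k : ℕ} (hjk : j + 1 = k ∨ k + 1 = j) (h : WordSorts A [j, k, j] L B) :
    ∃ M, LabelBraid L M ∧ WordSorts A [k, j, k] M B := by
  obtain ⟨P, x, y, Q, L₁, hxy, hP, rfl, rfl, h1⟩ := h.of_cons
  obtain ⟨P', x', y', Q', P'', x'', y'', Q'', hxy', hxy'', hP', hP'', he, he', rfl, rfl⟩ :=
    h1.of_pair
  obtain rfl | rfl := hjk
  · obtain ⟨rfl, h2⟩ := List.append_inj (he.symm.trans (show P ++ y :: x :: Q = (P ++ [y]) ++ x :: Q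
      by simp)) (by simp [hP, hP'])
    rcases Q with _ | ⟨z, Q⟩
    · simp at h2
    simp only [List.cons.injEq] at h2
    obtain ⟨rfl, rfl, rfl⟩ := h2
    obtain ⟨rfl, h3⟩ := List.append_inj (he'.symm.trans (show (P ++ [y]) ++ y' :: x' :: Q' =
      P ++ y :: y' :: x' :: Q' by simp)) (by simp [hP, hP''])
    simp only [List.cons.injEq] at h3
    obtain ⟨rfl, rfl, rfl⟩ := h3
    refine ⟨_, ⟨[], [], x', x'', y'', hxy, hxy'', .inl ⟨rfl, rfl⟩⟩, ?_⟩
    rw [← hP]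
    exact (braid_triple hxy hxy'').2
  · obtain ⟨P₀, t, rfl⟩ : ∃ P₀ t, P = P₀ ++ [t] := by
      rcases List.eq_nil_or_concat P with rfl | ⟨P₀, t, rfl⟩
      · simp at hP
      · exact ⟨P₀, t, by simp⟩
    simp only [List.length_append, List.length_cons, List.length_nil, zero_add,
      Nat.add_right_cancel_iff] at hP
    obtain ⟨rfl, h2⟩ := List.append_inj (he.symm.trans (show (P₀ ++ [t]) ++ y :: x :: Q =
      P₀ ++ t :: y :: x :: Q by simp)) (by simp [hP, hP'])
    simp only [List.cons.injEq] at h2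
    obtain ⟨rfl, rfl, rfl⟩ := h2
    obtain ⟨rfl, h3⟩ := List.append_inj (he'.symm.trans (show P' ++ y' :: x' :: x :: Q =
      (P' ++ [y']) ++ x' :: x :: Q by simp)) (by simp [hP, hP''])
    simp only [List.cons.injEq] at h3
    obtain ⟨rfl, rfl, rfl⟩ := h3
    refine ⟨_, ⟨[], [], x'', y'', y', hxy'', hxy, .inr ⟨rfl, rfl⟩⟩, ?_⟩
    rw [← hP]
    have := (braid_triple (P := P') (Q := Q'') hxy'' hxy).1
    simpa using this

/-- After (x, y) the strand x stands directly to the right of y, so the label (x, z) forces z to be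
the next entry; the three strands were consecutive. -/
theorem word_of_braid (hA : A.Nodup) {x y z : ℕ} (hxy : x < y) (hyz : y < z)
    (h : WordSorts A w [(x, y), (x, z), (y, z)] B) :
    ∃ j, w = [j, j + 1, j] ∧ WordSorts A [j + 1, j, j + 1] [(y, z), (x, z), (x, y)] B := by
  obtain ⟨P, Q, w₁, -, rfl, rfl, h1⟩ := h.of_cons_label
  have hA1 := (Sorts.single P hxy Q).perm.nodup_iff.1 hA
  obtain ⟨P', Q', w₂, hxz, he, rfl, h2⟩ := h1.of_cons_label
  have he1 : (P ++ [y]) ++ x :: Q = P' ++ x :: z :: Q' := by simpa using he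
  obtain ⟨rfl, rfl⟩ := append_cons_inj_of_nodup (by simpa using hA1) he1
  have := (braid_triple (P := P) (Q := Q') hxy hyz)
  obtain rfl : B = P ++ z :: y :: x :: Q' := by
    have h3 := word_unique hA h this.1
    exact (label_unique h (h3 ▸ this.1)).2
  exact ⟨P.length, word_unique hA h this.1, this.2⟩

theorem word_of_braid_reverse (hA : A.Nodup) {x y z : ℕ} (hxy : x < y) (hyz : y < z)
    (h : WordSorts A w [(y, z), (x, z), (x, y)] B) :
    ∃ j, w = [j + 1, j, j + 1] ∧ WordSorts A [j, j + 1, j] [(x, y), (x, z), (y, z)] B := by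
  obtain ⟨P, Q, w₁, -, rfl, rfl, h1⟩ := h.of_cons_label
  have hA1 := (Sorts.single P hyz Q).perm.nodup_iff.1 hA
  obtain ⟨P', Q', w₂, hxz, he, rfl, h2⟩ := h1.of_cons_label
  have he1 : P ++ z :: y :: Q = (P' ++ [x]) ++ z :: Q' := by simpa using he
  obtain ⟨rfl, rfl⟩ := append_cons_inj_of_nodup hA1 he1
  have := (braid_triple (P := P') (Q := Q) hxy hyz)
  have e : P' ++ [x] ++ y :: z :: Q = P' ++ x :: y :: z :: Q := by simp
  rw [e] at h hA ⊢
  have h3 := word_unique hA h this.2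
  obtain rfl : B = P' ++ z :: y :: x :: Q := (label_unique h (h3 ▸ this.2)).2
  exact ⟨P'.length, h3, this.1⟩

end WordSorts

/-! ### Reduced words as sorting sequences -/

/-- The number of inversions of a list. -/
def invCount (A : List ℕ) : ℕ := pairSum (fun x y => if y < x then 1 else 0) A

theorem invCount_swap (P : List ℕ) {x y : ℕ} (h : x < y) (Q : List ℕ) :
    invCount (P ++ y :: x :: Q) = invCount (P ++ x :: y :: Q) + 1 := by
  have := pairSum_block (fun x y => if y < x then 1 else 0) P Q (List.Perm.swap y x [])
  simp [pairSum, h, h.le.not_gt] at this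
  exact this

theorem Sorts.invCount_eq {A B : List ℕ} {L : List (ℕ × ℕ)} (h : Sorts A L B) :
    invCount B = invCount A + L.length := by
  induction h with
  | nil => rfl
  | @cons P x y Q L B hxy h ih => rw [ih, invCount_swap P hxy Q, List.length_cons]; ring

theorem invCount_of_pairwise {A : List ℕ} (h : A.Pairwise (· < ·)) : invCount A = 0 :=
  pairSum_eq_zero (h.imp fun hab => if_neg hab.le.not_gt)

/-- The tail is sorted first, and then the least entry travels right to its place. -/
theorem exists_sorts {A B : List ℕ} (hA : A.Pairwise (· < ·)) (h : A.Perm B) :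
    ∃ L, Sorts A L B := by
  induction A generalizing B with
  | nil => exact ⟨[], by rw [List.nil_perm.1 h]; exact .nil _⟩
  | cons z A ih =>
    rw [List.pairwise_cons] at hA
    obtain ⟨P, Q, rfl⟩ := List.append_of_mem (h.mem_iff.1 (List.mem_cons_self ..))
    have hPQ : A.Perm (P ++ Q) := (List.perm_cons z).1 (h.trans List.perm_middle)
    obtain ⟨L, hL⟩ := ih hA.2 hPQ
    have h1 := hL.append_left [z]
    have h2 := Sorts.column (z := z) (P := P)
      (fun x hx => hA.1 x (hPQ.mem_iff.2 (by simp [hx]))) Q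
    exact ⟨_, h1.trans (by simpa using h2)⟩

/-- The one-line notation of `σ`, with the values relabelled by `f`. -/
def oneLine {n : ℕ} (f : Fin n → ℕ) (σ : Equiv.Perm (Fin n)) : List ℕ :=
  List.ofFn fun i => f (σ i)

section OneLine

variable {n : ℕ} {f : Fin n → ℕ}

theorem oneLine_nodup (hf : StrictMono f) (σ : Equiv.Perm (Fin n)) : (oneLine f σ).Nodup :=
  List.nodup_ofFn.2 (hf.injective.comp σ.injective)

theorem oneLine_one_pairwise (hf : StrictMono f) : (oneLine f 1).Pairwise (· < ·) := by
  rw [oneLine, List.pairwise_ofFn]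
  exact fun i j hij => hf hij

theorem oneLine_perm (f : Fin n → ℕ) (σ : Equiv.Perm (Fin n)) :
    (oneLine f 1).Perm (oneLine f σ) :=
  (Equiv.Perm.ofFn_comp_perm σ f).symm

theorem oneLine_injective (hf : StrictMono f) : Function.Injective (oneLine f) := by
  intro σ τ h
  have := List.ofFn_injective h
  exact Equiv.ext fun i => hf.injective (congrFun this i)

theorem oneLine_mul_simpleRefl (f : Fin n → ℕ) (σ : Equiv.Perm (Fin n)) (i : Fin (n - 1)) :
    ∃ P x y Q, P.length = i.val ∧ oneLine f σ = P ++ x :: y :: Q ∧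
      oneLine f (σ * simpleRefl i) = P ++ y :: x :: Q := by
  have hi : i.val + 1 < (oneLine f σ).length := by simp [oneLine]; omega
  refine ⟨(oneLine f σ).take i, (oneLine f σ)[i.val], (oneLine f σ)[i.val + 1],
    (oneLine f σ).drop (i + 2), by simp; omega, ?_, ?_⟩
  · rw [← List.drop_eq_getElem_cons, ← List.drop_eq_getElem_cons, List.take_append_drop]
  · apply List.ext_getElem
    · simp [oneLine]; omega
    · intro k h1 h2
      have hk : k < n := by simpa [oneLine] using h1
      have hlen : ((oneLine f σ).take i).length = i.val := by simp; omega
      rw [List.getElem_append]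
      split_ifs with hki
      · rw [hlen] at hki
        simp only [oneLine, List.getElem_ofFn, List.getElem_take, Equiv.Perm.mul_apply, simpleRefl]
        rw [Equiv.swap_apply_of_ne_of_ne] <;> simp [Fin.ext_iff] <;> omega
      · rw [hlen] at hki
        obtain ⟨d, rfl⟩ := Nat.exists_eq_add_of_le (not_lt.1 hki)
        rcases d with _ | _ | d
        · have e : i.val + 0 - ((oneLine f σ).take i).length = 0 := by omega
          simp only [e, List.getElem_cons_zero]
          simp [oneLine, simpleRefl]
        · have e : i.val + (0 + 1) - ((oneLine f σ).take i).length = 1 := by omega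
          simp only [e, List.getElem_cons_zero, List.getElem_cons_succ]
          simp [oneLine, simpleRefl]
        · have e : i.val + (d + 1 + 1) - ((oneLine f σ).take i).length = d + 2 := by omega
          simp only [e, List.getElem_cons_succ, List.getElem_drop]
          simp only [oneLine, List.getElem_ofFn, Equiv.Perm.mul_apply, simpleRefl]
          rw [Equiv.swap_apply_of_ne_of_ne]
          · congr 3; omega
          · simp [Fin.ext_iff]
          · simp [Fin.ext_iff]

theorem wordProd_concat (w : List (Fin (n - 1))) (i : Fin (n - 1)) :
    wordProd (w ++ [i]) = wordProd w * simpleRefl i := by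
  simp [wordProd]

/-- Each letter changes the number of inversions by ±1. If it reaches the length of the word, every
letter creates an inversion and is thus a sorting step. -/
theorem invCount_wordProd (hf : StrictMono f) (w : List (Fin (n - 1))) :
    invCount (oneLine f (wordProd w)) ≤ w.length ∧
      (invCount (oneLine f (wordProd w)) = w.length →
        ∃ L, WordSorts (oneLine f 1) (w.map Fin.val) L (oneLine f (wordProd w))) := by
  induction w using List.reverseRecOn with
  | nil =>
    refine ⟨?_, fun _ => ⟨[], .nil _⟩⟩
    exact (invCount_of_pairwise (oneLine_one_pairwise hf)).le
  | append_singleton w i ih =>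
    rw [wordProd_concat]
    obtain ⟨P, x, y, Q, hP, h1, h2⟩ := oneLine_mul_simpleRefl f (wordProd w) i
    have hnd := oneLine_nodup hf (wordProd w)
    rw [h1] at hnd ih
    have hxy : x ≠ y := by
      have := (List.nodup_append.1 hnd).2.1
      simp only [List.nodup_cons, List.mem_cons, not_or] at this
      exact this.1.1
    rw [h2, List.length_append, List.length_singleton]
    rcases hxy.lt_or_gt with h | h
    · rw [invCount_swap P h Q]
      refine ⟨by omega, fun he => ?_⟩
      obtain ⟨L, hL⟩ := ih.2 (by omega)
      refine ⟨L ++ [(x, y)], ?_⟩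
      rw [List.map_append]
      refine hL.trans (M := [(x, y)]) ?_
      have := WordSorts.cons (P := P) (Q := Q) h (.nil _)
      simpa [hP] using this
    · have := invCount_swap P h Q
      exact ⟨by omega, fun he => by omega⟩

theorem WordSorts.eq_oneLine {τ : Equiv.Perm (Fin n)} {w : List (Fin (n - 1))}
    {L : List (ℕ × ℕ)} {B : List ℕ} (h : WordSorts (oneLine f τ) (w.map Fin.val) L B) :
    B = oneLine f (τ * wordProd w) := by
  induction w generalizing τ L with
  | nil => simpa [wordProd] using h.of_nil.2.symm
  | cons i w ih =>
    obtain ⟨P, x, y, Q, M, -, hP, he, rfl, h1⟩ := h.of_cons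
    obtain ⟨P', x', y', Q', hP', he', h2⟩ := oneLine_mul_simpleRefl f τ i
    obtain ⟨rfl, h3⟩ := List.append_inj (he.symm.trans he') (hP.trans hP'.symm)
    simp only [List.cons.injEq] at h3
    obtain ⟨rfl, rfl, rfl⟩ := h3
    rw [← h2] at h1
    rw [ih h1, mul_assoc]
    simp [wordProd]

theorem exists_fin_word {σ : Equiv.Perm (Fin n)} {w : List ℕ} {L : List (ℕ × ℕ)} {B : List ℕ}
    (h : WordSorts (oneLine f σ) w L B) : ∃ w' : List (Fin (n - 1)), w'.map Fin.val = w := by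
  have h1 : ∀ i ∈ w, i < n - 1 := by
    intro i hi
    have := h.lt_length i hi
    simp [oneLine] at this
    omega
  clear h
  induction w with
  | nil => exact ⟨[], rfl⟩
  | cons i w ih =>
    obtain ⟨w', rfl⟩ := ih fun j hj => h1 j (by simp [hj])
    exact ⟨⟨i, h1 i (by simp)⟩ :: w', by simp⟩

theorem permLength_le {σ : Equiv.Perm (Fin n)} {w : List (Fin (n - 1))} (h : wordProd w = σ) :
    permLength σ ≤ w.length := Nat.sInf_le ⟨w, rfl, h⟩

/-- Reduced words are the words along which the one-line notation is sorted stepwise. -/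
theorem mem_reducedWords_iff (hf : StrictMono f) {σ : Equiv.Perm (Fin n)}
    {w : List (Fin (n - 1))} : w ∈ reducedWords σ ↔
      ∃ L, WordSorts (oneLine f 1) (w.map Fin.val) L (oneLine f σ) := by
  have h0 := invCount_of_pairwise (oneLine_one_pairwise hf)
  have hlen : ∀ {v : List (Fin (n - 1))} {L}, WordSorts (oneLine f 1) (v.map Fin.val) L (oneLine f σ) →
      wordProd v = σ ∧ v.length = invCount (oneLine f σ) := by
    intro v L h
    have h1 := h.eq_oneLine
    rw [one_mul] at h1
    have h2 := h.sorts.invCount_eq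
    have h3 := h.length_eq
    rw [List.length_map] at h3
    exact ⟨(oneLine_injective hf h1).symm, by omega⟩
  constructor
  · rintro ⟨rfl, hw⟩
    refine (invCount_wordProd hf w).2 (le_antisymm (invCount_wordProd hf w).1 ?_)
    -- Some sorting sequence exists, and its length is the inversion number, so the minimal length
    -- is at most that number.
    obtain ⟨L, hL⟩ := exists_sorts (oneLine_one_pairwise hf) (oneLine_perm f (wordProd w))
    obtain ⟨v, hv⟩ := WordSorts.of_sorts hL
    obtain ⟨v, rfl⟩ := exists_fin_word hv
    obtain ⟨h1, h2⟩ := hlen hv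
    rw [hw, ← h2]
    exact permLength_le h1
  · rintro ⟨L, hL⟩
    obtain ⟨h1, h2⟩ := hlen hL
    refine ⟨h1, le_antisymm ?_ (permLength_le h1)⟩
    obtain ⟨v, hv, hvσ⟩ := Nat.sInf_mem
      (s := {k : ℕ | ∃ w : List (Fin (n - 1)), w.length = k ∧ wordProd w = σ}) ⟨_, w, rfl, h1⟩
    change v.length = permLength σ at hv
    rw [h2, ← hv, ← hvσ]
    exact (invCount_wordProd hf v).1

theorem exists_mem_reducedWords (hf : StrictMono f) {σ : Equiv.Perm (Fin n)} {L : List (ℕ × ℕ)}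
    (h : Sorts (oneLine f 1) L (oneLine f σ)) :
    ∃ u : reducedWords σ, WordSorts (oneLine f 1) (u.val.map Fin.val) L (oneLine f σ) := by
  obtain ⟨w, hw⟩ := WordSorts.of_sorts h
  obtain ⟨w, rfl⟩ := exists_fin_word hw
  exact ⟨⟨w, (mem_reducedWords_iff hf).2 ⟨L, hw⟩⟩, hw⟩

theorem length_eq_permLength (hf : StrictMono f) {σ : Equiv.Perm (Fin n)} {L : List (ℕ × ℕ)}
    (h : Sorts (oneLine f 1) L (oneLine f σ)) : L.length = permLength σ := by
  obtain ⟨u, hu⟩ := exists_mem_reducedWords hf h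
  rw [← u.2.2, ← hu.length_eq, List.length_map]

end OneLine

/-! ### Moves on words and on labels -/

namespace WordSorts

variable {A B w : List ℕ} {L M : List (ℕ × ℕ)}

theorem commMove (hA : A.Nodup) {v w : List ℕ} {j k : ℕ} (hjk : j + 1 < k ∨ k + 1 < j)
    (h : WordSorts A (v ++ [j, k] ++ w) L B) :
    ∃ M, LabelComm L M ∧ WordSorts A (v ++ [k, j] ++ w) M B := by
  obtain ⟨L', L₃, C, rfl, h', h3⟩ := h.of_append_word
  obtain ⟨L₁, L₂, D, rfl, h1, h2⟩ := h'.of_append_word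
  obtain ⟨l, m, rfl, h4, P, Q, R, hD⟩ := comm_of_word hjk h2
  refine ⟨_, ⟨L₁, L₃, l, m, ?_, rfl, rfl⟩, (h1.trans h4).trans h3⟩
  have hnd := h1.sorts.perm.nodup_iff.1 hA
  rcases hD with rfl | rfl
  all_goals
    have := (List.nodup_append.1 hnd).2.1
    simp only [List.nodup_cons, List.mem_cons, List.mem_append, not_or] at this
    obtain ⟨⟨h5, h6, h7, h8, h9⟩, ⟨h10, h11, h12, h13⟩, h14⟩ := this
    first
    | exact ⟨h7, h8, h11, h12⟩
    | exact ⟨Ne.symm h7, Ne.symm h11, Ne.symm h8, Ne.symm h12⟩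

theorem braidMove {v w : List ℕ} {j k : ℕ} (hjk : j + 1 = k ∨ k + 1 = j)
    (h : WordSorts A (v ++ [j, k, j] ++ w) L B) :
    ∃ M, LabelBraid L M ∧ WordSorts A (v ++ [k, j, k] ++ w) M B := by
  obtain ⟨L', L₃, C, rfl, h', h3⟩ := h.of_append_word
  obtain ⟨L₁, L₂, D, rfl, h1, h2⟩ := h'.of_append_word
  obtain ⟨M, ⟨X, Y, x, y, z, hxy, hyz, hM⟩, h4⟩ := braid_of_word hjk h2
  refine ⟨_, ⟨L₁ ++ X, Y ++ L₃, x, y, z, hxy, hyz, ?_⟩, (h1.trans h4).trans h3⟩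
  rcases hM with ⟨rfl, rfl⟩ | ⟨rfl, rfl⟩
  · left; simp
  · right; simp

theorem labelComm (h : WordSorts A w L B) (hLM : LabelComm L M) :
    ∃ w₁ w₂ j k, (j + 1 < k ∨ k + 1 < j) ∧ w = w₁ ++ [j, k] ++ w₂ ∧
      WordSorts A (w₁ ++ [k, j] ++ w₂) M B := by
  obtain ⟨X, Y, l, m, hne, rfl, rfl⟩ := hLM
  obtain ⟨w', w₃, C, rfl, h', h3⟩ := h.of_append_label
  obtain ⟨w₁, w₂, D, rfl, h1, h2⟩ := h'.of_append_label
  obtain ⟨j, k, hjk, rfl, h4⟩ := comm_of_label hne h2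
  exact ⟨w₁, w₃, j, k, hjk, rfl, (h1.trans h4).trans h3⟩

theorem labelBraid (hA : A.Nodup) (h : WordSorts A w L B) (hLM : LabelBraid L M) :
    ∃ w₁ w₂ j k, (j + 1 = k ∨ k + 1 = j) ∧ w = w₁ ++ [j, k, j] ++ w₂ ∧
      WordSorts A (w₁ ++ [k, j, k] ++ w₂) M B := by
  obtain ⟨X, Y, x, y, z, hxy, hyz, ⟨rfl, rfl⟩ | ⟨rfl, rfl⟩⟩ := hLM
  · obtain ⟨w', w₃, C, rfl, h', h3⟩ := h.of_append_label
    obtain ⟨w₁, w₂, D, rfl, h1, h2⟩ := h'.of_append_label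
    obtain ⟨j, rfl, h4⟩ := word_of_braid (h1.sorts.perm.nodup_iff.1 hA) hxy hyz h2
    exact ⟨w₁, w₃, j, j + 1, .inl rfl, rfl, (h1.trans h4).trans h3⟩
  · obtain ⟨w', w₃, C, rfl, h', h3⟩ := h.of_append_label
    obtain ⟨w₁, w₂, D, rfl, h1, h2⟩ := h'.of_append_label
    obtain ⟨j, rfl, h4⟩ := word_of_braid_reverse (h1.sorts.perm.nodup_iff.1 hA) hxy hyz h2
    exact ⟨w₁, w₃, j + 1, j, .inr rfl, rfl, (h1.trans h4).trans h3⟩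

end WordSorts

/-- Weighted paths of reduced words. -/
abbrev WordReach {n : ℕ} (σ : Equiv.Perm (Fin n)) (p q : ℕ) :
    reducedWords σ → reducedWords σ → ℕ → Prop :=
  Reach (commEdges σ).Adj (braidEdges σ).Adj p q

section Transfer

variable {n : ℕ} {f : Fin n → ℕ} {σ : Equiv.Perm (Fin n)} {p q c : ℕ}

theorem WordReach.labelReach (hf : StrictMono f) {u v : reducedWords σ}
    (h : WordReach σ p q u v c) {L M : List (ℕ × ℕ)}
    (hL : WordSorts (oneLine f 1) (u.val.map Fin.val) L (oneLine f σ))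
    (hM : WordSorts (oneLine f 1) (v.val.map Fin.val) M (oneLine f σ)) :
    LabelReach p q L M c := by
  induction h generalizing L with
  | refl u => rw [(hL.label_unique hM).1]; exact .refl _
  | @fst u u' v c h _ ih =>
    obtain ⟨w₁, w₂, j, k, hjk, hu, hu'⟩ := h
    rw [hu, List.map_append, List.map_append] at hL
    obtain ⟨N, hLN, hN⟩ := WordSorts.commMove (oneLine_nodup hf 1) hjk hL
    exact .fst hLN (ih (by rw [hu', List.map_append, List.map_append]; exact hN) hM)
  | @snd u u' v c h _ ih =>
    obtain ⟨w₁, w₂, j, k, hjk, hu, hu'⟩ := h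
    rw [hu, List.map_append, List.map_append] at hL
    obtain ⟨N, hLN, hN⟩ := WordSorts.braidMove hjk hL
    exact .snd hLN (ih (by rw [hu', List.map_append, List.map_append]; exact hN) hM)

theorem LabelReach.wordReach (hf : StrictMono f) {L M : List (ℕ × ℕ)}
    (h : LabelReach p q L M c) {u v : reducedWords σ}
    (hL : WordSorts (oneLine f 1) (u.val.map Fin.val) L (oneLine f σ))
    (hM : WordSorts (oneLine f 1) (v.val.map Fin.val) M (oneLine f σ)) :
    WordReach σ p q u v c := by
  have hinj : Function.Injective (List.map (Fin.val : Fin (n - 1) → ℕ)) :=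
    List.map_injective_iff.2 Fin.val_injective
  induction h generalizing u with
  | refl L =>
    obtain rfl : u = v :=
      Subtype.ext (hinj (WordSorts.word_unique (oneLine_nodup hf 1) hL hM))
    exact .refl _
  | @fst L N M c h _ ih =>
    obtain ⟨w₁, w₂, j, k, hjk, hu, hN⟩ := hL.labelComm h
    obtain ⟨x, y, hxy, hx, hy⟩ := List.map_eq_append_iff.1 hu
    obtain ⟨s, t, hst, hs, ht⟩ := List.map_eq_append_iff.1 hx
    subst hy hs
    obtain ⟨j', k', rfl, rfl, rfl⟩ : ∃ j' k', t = [j', k'] ∧ j'.val = j ∧ k'.val = k := by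
      rcases t with _ | ⟨j', _ | ⟨k', _ | _⟩⟩ <;> simp at ht
      exact ⟨j', k', rfl, ht.1, ht.2⟩
    have hN' : WordSorts (oneLine f 1) ((s ++ [k', j'] ++ y).map Fin.val) N (oneLine f σ) := by
      simpa using hN
    let u' : reducedWords σ := ⟨s ++ [k', j'] ++ y, (mem_reducedWords_iff hf).2 ⟨N, hN'⟩⟩
    exact .fst (v := u') ⟨s, y, j', k', hjk, by rw [hxy, hst], rfl⟩ (ih hN' hM)
  | @snd L N M c h _ ih =>
    obtain ⟨w₁, w₂, j, k, hjk, hu, hN⟩ := hL.labelBraid (oneLine_nodup hf 1) h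
    obtain ⟨x, y, hxy, hx, hy⟩ := List.map_eq_append_iff.1 hu
    obtain ⟨s, t, hst, hs, ht⟩ := List.map_eq_append_iff.1 hx
    subst hy hs
    obtain ⟨j', k', rfl, rfl, rfl⟩ : ∃ j' k', t = [j', k', j'] ∧ j'.val = j ∧ k'.val = k := by
      rcases t with _ | ⟨j', _ | ⟨k', _ | ⟨l', _ | _⟩⟩⟩ <;> simp at ht
      obtain rfl : l' = j' := Fin.ext (ht.2.2.trans ht.1.symm)
      exact ⟨l', k', rfl, ht.1, ht.2.1⟩
    have hN' : WordSorts (oneLine f 1) ((s ++ [k', j', k'] ++ y).map Fin.val) N (oneLine f σ) := by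
      simpa using hN
    let u' : reducedWords σ := ⟨s ++ [k', j', k'] ++ y, (mem_reducedWords_iff hf).2 ⟨N, hN'⟩⟩
    exact .snd (v := u') ⟨s, y, j', k', hjk, by rw [hxy, hst], rfl⟩ (ih hN' hM)

end Transfer

/-- `D` is the largest weighted distance between elements of `V`. -/
def WeightedDiam {V : Type*} (r s : V → V → Prop) (p q D : ℕ) : Prop :=
  (∀ u v, ∃ c ≤ D, Reach r s p q u v c) ∧ ∃ u v, ∀ c, Reach r s p q u v c → D ≤ c

theorem WeightedDiam.labelDiam {n : ℕ} {f : Fin n → ℕ} {σ : Equiv.Perm (Fin n)} {p q D : ℕ}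
    (hf : StrictMono f) (h : WeightedDiam (commEdges σ).Adj (braidEdges σ).Adj p q D) :
    LabelDiam p q (oneLine f 1) (oneLine f σ) D := by
  obtain ⟨h1, u, v, h2⟩ := h
  constructor
  · intro L M hL hM
    obtain ⟨u, hu⟩ := exists_mem_reducedWords hf hL
    obtain ⟨v, hv⟩ := exists_mem_reducedWords hf hM
    obtain ⟨c, hc, hR⟩ := h1 u v
    exact ⟨c, hc, WordReach.labelReach hf hR hu hv⟩
  · obtain ⟨L, hL⟩ := (mem_reducedWords_iff hf).1 u.2
    obtain ⟨M, hM⟩ := (mem_reducedWords_iff hf).1 v.2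
    exact ⟨L, M, hL.sorts, hM.sorts, fun c hc => h2 c (LabelReach.wordReach hf hc hL hM)⟩

theorem exists_wordReach {n : ℕ} {σ : Equiv.Perm (Fin n)} (p q : ℕ) (u v : reducedWords σ) :
    ∃ c, WordReach σ p q u v c := by
  obtain ⟨L, hL⟩ := (mem_reducedWords_iff Fin.val_strictMono).1 u.2
  obtain ⟨M, hM⟩ := (mem_reducedWords_iff Fin.val_strictMono).1 v.2
  obtain ⟨c, hc⟩ := hL.sorts.exists_reach p q (oneLine_nodup Fin.val_strictMono 1) hM.sorts
  exact ⟨c, LabelReach.wordReach Fin.val_strictMono hc hL hM⟩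

instance nonempty_reducedWords {n : ℕ} (σ : Equiv.Perm (Fin n)) : Nonempty (reducedWords σ) := by
  obtain ⟨L, hL⟩ := exists_sorts (oneLine_one_pairwise Fin.val_strictMono) (oneLine_perm Fin.val σ)
  obtain ⟨u, -⟩ := exists_mem_reducedWords Fin.val_strictMono hL
  exact ⟨u⟩

instance finite_reducedWords {n : ℕ} (σ : Equiv.Perm (Fin n)) : Finite (reducedWords σ) :=
  ((List.finite_length_eq (Fin (n - 1)) (permLength σ)).subset fun _ h => h.2).to_subtype

/-! ### Contracted graphs -/

section Contract

variable {V : Type*} (H K : SimpleGraph V)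

/-- Moving within a component is free. An edge between different components cannot come from `H`, so
it is a `K`-edge of cost 1. -/
theorem contract_reach_of_walk {S T : H.ConnectedComponent} (w : (contract (H ⊔ K) H).Walk S T)
    {u v : V} (hu : H.connectedComponentMk u = S) (hv : H.connectedComponentMk v = T) :
    Reach H.Adj K.Adj 0 1 u v w.length := by
  have hH : ∀ u v, H.Reachable u v → Reach H.Adj K.Adj 0 1 u v 0 := by
    rintro u v ⟨w⟩
    induction w with
    | nil => exact .refl _
    | cons h _ ih => exact .fst h ih
  induction w generalizing u with
  | nil => exact hH u v (SimpleGraph.ConnectedComponent.exact (hu.trans hv.symm))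
  | cons h w ih =>
    have hadj := h
    obtain ⟨hne, s, t, hs, ht, hst⟩ := hadj
    have h1 := hH u s (SimpleGraph.ConnectedComponent.exact (hu.trans hs.symm))
    rcases hst with hst | hst
    · exact absurd (hs.symm.trans
        ((SimpleGraph.ConnectedComponent.sound hst.reachable).trans ht)) hne
    · have h2 := h1.trans (.snd hst (ih ht hv))
      rwa [SimpleGraph.Walk.length_cons, add_comm, ← zero_add (1 + w.length)]

/-- Only an inequality holds, since a `K`-edge inside a component costs 1 but gives no edge after
contraction. -/
theorem Reach.exists_contract_walk {u v : V} {c : ℕ} (h : Reach H.Adj K.Adj 0 1 u v c) :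
    ∃ w : (contract (H ⊔ K) H).Walk (H.connectedComponentMk u) (H.connectedComponentMk v),
      w.length ≤ c := by
  induction h with
  | refl u => exact ⟨.nil, le_rfl⟩
  | @fst u u' v c h _ ih =>
    obtain ⟨w, hw⟩ := ih
    have he := SimpleGraph.ConnectedComponent.sound h.reachable
    exact ⟨w.copy he.symm rfl, by simpa using hw⟩
  | @snd u u' v c h _ ih =>
    obtain ⟨w, hw⟩ := ih
    by_cases he : H.connectedComponentMk u = H.connectedComponentMk u'
    · exact ⟨w.copy he.symm rfl, by simp; omega⟩
    · have hadj : (contract (H ⊔ K) H).Adj (H.connectedComponentMk u) (H.connectedComponentMk u') :=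
        ⟨he, u, u', rfl, rfl, .inr h⟩
      refine ⟨.cons hadj w, ?_⟩
      rw [SimpleGraph.Walk.length_cons]
      omega

theorem sup_reach_of_walk {u v : V} (w : (H ⊔ K).Walk u v) :
    Reach H.Adj K.Adj 1 1 u v w.length := by
  induction w with
  | nil => exact .refl _
  | cons h w ih =>
    rw [SimpleGraph.Walk.length_cons, add_comm]
    rcases h with h | h
    · exact .fst h ih
    · exact .snd h ih

theorem Reach.exists_sup_walk {u v : V} {c : ℕ} (h : Reach H.Adj K.Adj 1 1 u v c) :
    ∃ w : (H ⊔ K).Walk u v, w.length ≤ c := by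
  induction h with
  | refl u => exact ⟨.nil, le_rfl⟩
  | fst h _ ih =>
    obtain ⟨w, hw⟩ := ih
    exact ⟨.cons (.inl h) w, by simp; omega⟩
  | snd h _ ih =>
    obtain ⟨w, hw⟩ := ih
    exact ⟨.cons (.inr h) w, by simp; omega⟩

theorem Reach.swap {r s : V → V → Prop} {p q : ℕ} {u v : V} {c : ℕ} (h : Reach r s p q u v c) :
    Reach s r q p u v c := by
  induction h with
  | refl u => exact .refl u
  | fst h _ ih => exact .snd h ih
  | snd h _ ih => exact .fst h ih

/-- If weighted paths correspond to walks of a graph on a quotient, then this graph is connected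
and its diameter is the largest weighted distance. -/
theorem connected_and_weightedDiam {W : Type*} [Finite V] [Nonempty V] {r s : V → V → Prop}
    {p q : ℕ} (G : SimpleGraph W) (φ : V → W) (hφ : Function.Surjective φ)
    (hr : ∀ u v, ∃ c, Reach r s p q u v c)
    (h1 : ∀ u v c, Reach r s p q u v c → ∃ w : G.Walk (φ u) (φ v), w.length ≤ c)
    (h2 : ∀ u v (w : G.Walk (φ u) (φ v)), Reach r s p q u v w.length) :
    G.Connected ∧ WeightedDiam r s p q G.diam := by
  have : Finite W := Finite.of_surjective φ hφ
  have : Nonempty W := ⟨φ (Classical.arbitrary V)⟩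
  have hc : G.Connected := by
    refine ⟨fun S T => ?_⟩
    obtain ⟨u, rfl⟩ := hφ S
    obtain ⟨v, rfl⟩ := hφ T
    obtain ⟨c, hc⟩ := hr u v
    obtain ⟨w, -⟩ := h1 u v c hc
    exact ⟨w⟩
  refine ⟨hc, fun u v => ?_, ?_⟩
  · obtain ⟨w, hw⟩ := hc.exists_walk_length_eq_dist (φ u) (φ v)
    refine ⟨w.length, ?_, h2 u v w⟩
    rw [hw]
    -- A connected finite graph has finite extended diameter, so `diam` is not the default value 0
    -- of the infinite case.
    exact SimpleGraph.dist_le_diam (SimpleGraph.connected_iff_ediam_ne_top.1 hc)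
  · obtain ⟨S, T, hST⟩ := G.exists_dist_eq_diam
    obtain ⟨u, rfl⟩ := hφ S
    obtain ⟨v, rfl⟩ := hφ T
    refine ⟨u, v, fun c hcR => ?_⟩
    obtain ⟨w, hw⟩ := h1 u v c hcR
    rw [← hST]
    exact (SimpleGraph.dist_le w).trans hw

end Contract

section Graphs

variable {n : ℕ} (σ : Equiv.Perm (Fin n))

theorem graphG_connected_and_weightedDiam : (graphG σ).Connected ∧
    WeightedDiam (commEdges σ).Adj (braidEdges σ).Adj 1 1 (graphG σ).diam :=
  connected_and_weightedDiam _ id Function.surjective_id (exists_wordReach 1 1)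
    (fun _ _ _ h => h.exists_sup_walk) fun _ _ w => sup_reach_of_walk _ _ w

theorem graphC_connected_and_weightedDiam : (graphC σ).Connected ∧
    WeightedDiam (commEdges σ).Adj (braidEdges σ).Adj 0 1 (graphC σ).diam :=
  connected_and_weightedDiam _ (commEdges σ).connectedComponentMk Quot.mk_surjective
    (exists_wordReach 0 1) (fun _ _ _ h => h.exists_contract_walk)
    fun _ _ w => contract_reach_of_walk _ _ w rfl rfl

theorem graphB_connected_and_weightedDiam : (graphB σ).Connected ∧
    WeightedDiam (commEdges σ).Adj (braidEdges σ).Adj 1 0 (graphB σ).diam := by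
  have h : graphB σ = contract (braidEdges σ ⊔ commEdges σ) (braidEdges σ) := by
    rw [graphB, graphG, sup_comm]
  rw [h]
  exact connected_and_weightedDiam _ (braidEdges σ).connectedComponentMk Quot.mk_surjective
    (exists_wordReach 1 0) (fun _ _ _ h => h.swap.exists_contract_walk)
    fun _ _ w => (contract_reach_of_walk _ _ w rfl rfl).swap

end Graphs

/-! ### The inflation -/

/-- With its values raised by b, the diagram of α becomes literally the large part of the diagram of
π; this is what the relabelling in `oneLine` is for. -/
theorem oneLine_val_one_add (a b : ℕ) : oneLine (Fin.val : Fin (a + b) → ℕ) 1 =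
    List.range b ++ oneLine (fun i : Fin a => i.val + b) 1 := by
  have h1 : oneLine (Fin.val : Fin (a + b) → ℕ) 1 = List.range (a + b) := by
    apply List.ext_getElem <;> simp [oneLine]
  have h2 : oneLine (fun i : Fin a => i.val + b) 1 = (List.range a).map (b + ·) := by
    apply List.ext_getElem <;> simp [oneLine, add_comm]
  rw [h1, h2, add_comm, List.range_add]

theorem oneLine_val_inflate21 {a : ℕ} (b : ℕ) (α : Equiv.Perm (Fin a)) :
    oneLine Fin.val (inflate21 α (1 : Equiv.Perm (Fin b))) =
      oneLine (fun i : Fin a => i.val + b) α ++ List.range b := by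
  have h2 : List.range b = List.ofFn fun i : Fin b => i.val := by
    apply List.ext_getElem <;> simp
  rw [oneLine, List.ofFn_add, h2, oneLine]
  congr 1
  · congr 1; funext i; exact inflate21_left α 1 i
  · congr 1; funext i; exact inflate21_right α 1 i

/-- The weighted form of the diameter estimates. -/
theorem weightedDiam_inflate21 {a b p q D D' : ℕ} {α : Equiv.Perm (Fin a)}
    {π : Equiv.Perm (Fin (a + b))} (hπ : π = inflate21 α (1 : Equiv.Perm (Fin b)))
    (hD : WeightedDiam (commEdges α).Adj (braidEdges α).Adj p q D)
    (hD' : WeightedDiam (commEdges π).Adj (braidEdges π).Adj p q D') :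
    D + permLength α * (b * ((a - 2) * p + q)) + p * (a.choose 2 * b.choose 2) ≤ D' ∧
      D' ≤ D + permLength α * (b * ((a - 2) * p + q)) + 2 * (p * (a.choose 2 * b.choose 2)) := by
  have hf : StrictMono fun i : Fin a => i.val + b := fun i j h => by simpa using h
  have h1 := hD.labelDiam hf
  have h2 := hD'.labelDiam Fin.val_strictMono
  rw [hπ, oneLine_val_one_add, oneLine_val_inflate21] at h2
  have hb : ∀ x ∈ oneLine (fun i : Fin a => i.val + b) 1, b ≤ x := by
    intro x hx
    obtain ⟨i, rfl⟩ := (List.mem_ofFn' _ _).1 hx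
    simp
  have hk := fun u (hu : Sorts _ u (oneLine (fun i : Fin a => i.val + b) α)) =>
    length_eq_permLength hf hu
  have h3 := LabelDiam.lower (oneLine_nodup hf 1) hb hk h1 h2
  have h4 := LabelDiam.upper (oneLine_nodup hf 1) hb hk h1 h2
  simp only [oneLine, List.length_ofFn] at h3 h4
  exact ⟨h3, h4⟩

theorem permLength_eq_zero {a : ℕ} (α : Equiv.Perm (Fin a)) (ha : a < 2) : permLength α = 0 := by
  have : Subsingleton (Fin a) := Fin.subsingleton_iff_le_one.2 (by omega)
  exact Nat.le_zero.1 (permLength_le (w := []) (Subsingleton.elim _ _))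

end ReducedWords

open ReducedWords in
theorem theorem4p6 (a b : ℕ) (α : Equiv.Perm (Fin a)) (π : Equiv.Perm (Fin (a + b)))
    (hπ : π = inflate21 α (1 : Equiv.Perm (Fin b))) :
    -- the six graphs are connected, so that their diameters are genuine maxima of distances
    ((graphG α).Connected ∧ (graphC α).Connected ∧ (graphB α).Connected ∧
      (graphG π).Connected ∧ (graphC π).Connected ∧ (graphB π).Connected) ∧
    -- (i)
    (((graphG α).diam : ℤ) + permLength α * b * ((a : ℤ) - 1) + a.choose 2 * b.choose 2
        ≤ (graphG π).diam ∧
      ((graphG π).diam : ℤ)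
        ≤ (graphG α).diam + permLength α * b * ((a : ℤ) - 1) + 2 * (a.choose 2 * b.choose 2)) ∧
    -- (ii)
    (graphC π).diam = (graphC α).diam + permLength α * b ∧
    -- (iii)
    (((graphB α).diam : ℤ) + permLength α * b * ((a : ℤ) - 2) + a.choose 2 * b.choose 2
        ≤ (graphB π).diam ∧
      ((graphB π).diam : ℤ)
        ≤ (graphB α).diam + permLength α * b * ((a : ℤ) - 2) + 2 * (a.choose 2 * b.choose 2)) := by
  obtain ⟨cGα, dGα⟩ := graphG_connected_and_weightedDiam α
  obtain ⟨cCα, dCα⟩ := graphC_connected_and_weightedDiam α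
  obtain ⟨cBα, dBα⟩ := graphB_connected_and_weightedDiam α
  obtain ⟨cGπ, dGπ⟩ := graphG_connected_and_weightedDiam π
  obtain ⟨cCπ, dCπ⟩ := graphC_connected_and_weightedDiam π
  obtain ⟨cBπ, dBπ⟩ := graphB_connected_and_weightedDiam π
  obtain ⟨hG1, hG2⟩ := weightedDiam_inflate21 hπ dGα dGπ
  obtain ⟨hC1, hC2⟩ := weightedDiam_inflate21 hπ dCα dCπ
  obtain ⟨hB1, hB2⟩ := weightedDiam_inflate21 hπ dBα dBπ
  -- For a < 2 the natural subtraction truncates, but then ℓ(α) = 0 and both sides vanish.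
  have key : ((permLength α * (b * (a - 2)) : ℕ) : ℤ) = permLength α * b * ((a : ℤ) - 2) := by
    rcases lt_or_ge a 2 with ha | ha
    · simp [permLength_eq_zero α ha]
    · push_cast [Nat.cast_sub ha]; ring
  have hG : permLength α * (b * ((a - 2) * 1 + 1)) =
      permLength α * (b * (a - 2)) + permLength α * b := by ring
  have hGz : (permLength α * b * ((a : ℤ) - 1)) =
      permLength α * b * ((a : ℤ) - 2) + ((permLength α * b : ℕ) : ℤ) := by push_cast; ring
  rw [hG] at hG1 hG2
  simp only [mul_one, mul_zero, zero_mul, one_mul, add_zero, zero_add] at hG1 hG2 hC1 hC2 hB1 hB2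
  refine ⟨⟨cGα, cCα, cBα, cGπ, cCπ, cBπ⟩, ⟨?_, ?_⟩, le_antisymm hC2 hC1, ?_, ?_⟩
  · rw [hGz, ← key]; exact_mod_cast (by omega)
  · rw [hGz, ← key]; exact_mod_cast (by omega)
  · rw [← key]; exact_mod_cast hB1
  · rw [← key]; exact_mod_cast hB2
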